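/- Let $\mathcal P$ be a normed plane ($\mathbb R^2$ with a norm) whose unit circle is smooth and quadratically convex (i.e. of positive curvature). Parametrize the unit circle smoothly by $p(\theta)$, $\theta\in\mathbb R$, where $\theta$ is the angle of the tangent vector $p'(\theta)\neq0$ with a fixed direction, so that $p(\theta+\pi)=-p(\theta)$. Write $[a,b]$ for the determinant of two plane vectors and $q=p'/[p,p']$ for the parametrization of the dual unit circle. Consider the equation $$\frac{1}{[p,p']}\left(\frac{u'}{[q,q']}\right)'=-\lambda u. \qquad (1)$$ An eigenfunction with eigenvalue $\lambda$ is a nonzero $2\pi$-periodic solution $u$ of (1). Its index is the number of clockwise turns that the closed plane curve $(u,\,u'/[q,q'])$ makes around the origin for $\theta\in[0,2\pi]$. For $k\ge1$ let $\lambda_k^1\le\lambda_k^2$ be the smallest and the largest eigenvalue that has an eigenfunction of index $k$, and let $h_k^1,h_k^2$ be eigenfunctions with eigenvalues $\lambda_k^1,\lambda_k^2$ that are orthonormal for the inner product $$\langle f,g\rangle=\int_0^{2\pi} f(\theta)\,g(\theta)\,[p,p'](\theta)\,d\theta .$$ Let $k_0\ge 2$ and let $h:\mathbb R\to\mathbb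 R$ be a continuous $2\pi$-periodic function with an expansion $$h=\sum_{k\ge k_0}\left(a_k^1h_k^1+a_k^2h_k^2\right),\qquad a_k^i\in\mathbb R,$$ converging in the norm of this inner product. Then $h$ has at least $2k_0$ distinct zeros in $[0,2\pi)$. -/

import Mathlib

open Filter Topology
open scoped ContDiff

namespace MinkowskiPlane

/-- The determinant `[a, b]` of a pair of vectors of the plane. -/
def det (a b : ℝ × ℝ) : ℝ := a.1 * b.2 - a.2 * b.1

/-- `p` parametrizes the unit circle of the norm `N` on `ℝ²` smoothly and regularly by the angle
`θ` that the tangent makes with a fixed direction. Such a parametrization exists exactly when the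
unit circle is smooth and quadratically convex (of positive curvature, here `1 / ρ`). -/
structure IsUnitCircle (N : Seminorm ℝ (ℝ × ℝ)) (p : ℝ → ℝ × ℝ) : Prop where
  definite : ∀ x, N x = 0 → x = 0
  smooth : ContDiff ℝ ∞ p
  range_eq : Set.range p = {x | N x = 1}
  antipodal : ∀ θ, p (θ + Real.pi) = -p θ
  tangent : ∃ c : ℝ, ∀ θ, ∃ ρ : ℝ, 0 < ρ ∧
    deriv p θ = (ρ * Real.cos (θ + c), ρ * Real.sin (θ + c))

/-- The weight `[p, p']`. -/
noncomputable def weight (p : ℝ → ℝ × ℝ) (θ : ℝ) : ℝ := det (p θ) (deriv p θ)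

/-- The parametrization `q = p' / [p, p']` of the dual unit circle. -/
noncomputable def dual (p : ℝ → ℝ × ℝ) (θ : ℝ) : ℝ × ℝ := (weight p θ)⁻¹ • deriv p θ

/-- The quotient `u' / [q, q']`. -/
noncomputable def quasiDeriv (p : ℝ → ℝ × ℝ) (u : ℝ → ℝ) (θ : ℝ) : ℝ :=
  deriv u θ / weight (dual p) θ

/-- `u` is a (classical) solution of `(1 / [p, p']) (u' / [q, q'])' = -lam u`. -/
structure IsSolution (p : ℝ → ℝ × ℝ) (lam : ℝ) (u : ℝ → ℝ) : Prop where
  differentiable : Differentiable ℝ u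
  differentiable_quasiDeriv : Differentiable ℝ (quasiDeriv p u)
  eqn : ∀ θ, (weight p θ)⁻¹ * deriv (quasiDeriv p u) θ = -lam * u θ

/-- `u` is an eigenfunction: a nonzero `2π`-periodic solution. -/
structure IsEigenfunction (p : ℝ → ℝ × ℝ) (lam : ℝ) (u : ℝ → ℝ) : Prop where
  isSolution : IsSolution p lam u
  periodic : Function.Periodic u (2 * Real.pi)
  ne_zero : u ≠ 0

/-- The index of `u`: the total variation `-(1 / 2π) ∫ β'` over `[0, 2π]`, where `β` is the angle of
the plane vector `(u, w)`, `w = u' / [q, q']`, so that `-β' = (w u' - u w') / (u² + w²)`. For a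
closed curve it is the number of clockwise turns of `(u, w)` around the origin. -/
noncomputable def index (p : ℝ → ℝ × ℝ) (u : ℝ → ℝ) : ℝ :=
  1 / (2 * Real.pi) * ∫ θ in (0 : ℝ)..(2 * Real.pi),
    (quasiDeriv p u θ * deriv u θ - u θ * deriv (quasiDeriv p u) θ) /
      (u θ ^ 2 + quasiDeriv p u θ ^ 2)

/-- The eigenvalues that admit an eigenfunction of index `k`. -/
def eigenvaluesOfIndex (p : ℝ → ℝ × ℝ) (k : ℕ) : Set ℝ :=
  {lam | ∃ u, IsEigenfunction p lam u ∧ index p u = k}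

/-- The smallest (`i = 0`) and the largest (`i = 1`) eigenvalue of index `k`; these are
`λ_k^1 ≤ λ_k^2`. -/
noncomputable def eigenvalue (p : ℝ → ℝ × ℝ) (k : ℕ) (i : Fin 2) : ℝ :=
  if i = 0 then sInf (eigenvaluesOfIndex p k) else sSup (eigenvaluesOfIndex p k)

/-- The inner product `⟨f, g⟩ = ∫ f g [p, p'] dθ` over one period. -/
noncomputable def innerProd (p : ℝ → ℝ × ℝ) (f g : ℝ → ℝ) : ℝ :=
  ∫ θ in (0 : ℝ)..(2 * Real.pi), f θ * g θ * weight p θ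

/-- `e k 0, e k 1` (`k ≥ 1`) is a system of normalized eigenfunctions for `λ_k^1, λ_k^2`, orthogonal
for each `k`. (For different `k` the eigenvalues differ and orthogonality is automatic; the
constants are the remaining member of the basis.) -/
structure IsEigenbasis (p : ℝ → ℝ × ℝ) (e : ℕ → Fin 2 → ℝ → ℝ) : Prop where
  isEigenfunction : ∀ k, 1 ≤ k → ∀ i, IsEigenfunction p (eigenvalue p k i) (e k i)
  orthonormal : ∀ k, 1 ≤ k → ∀ i j, innerProd p (e k i) (e k j) = if i = j then 1 else 0

/-- `f = ∑_{k ≥ k₀} ∑_i a_k^i e_k^i`, convergence being that of the norm of the inner product. -/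
def HasExpansionFrom (p : ℝ → ℝ × ℝ) (e : ℕ → Fin 2 → ℝ → ℝ) (k₀ : ℕ)
    (a : ℕ → Fin 2 → ℝ) (f : ℝ → ℝ) : Prop :=
  Tendsto (fun n : ℕ =>
    innerProd p (fun θ => f θ - ∑ k ∈ Finset.Icc k₀ n, ∑ i, a k i * e k i θ)
      (fun θ => f θ - ∑ k ∈ Finset.Icc k₀ n, ∑ i, a k i * e k i θ)) atTop (𝓝 0)

end MinkowskiPlane

/-! This is Sturm's oscillation argument. If `h` has fewer than `2 * k₀` zeros, it changes sign at a
finite set `T` of points per period, and by periodicity `T` has an even number `2m` of elements,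
with `m < k₀`. The `2m + 1` functions `1`, `e k i` (`1 ≤ k ≤ m`) span a Chebyshev space: no nonzero
member has more than `2m` zeros per period. Linear algebra gives a nonzero `g` in the span vanishing
on `T`; the bound makes these its only zeros, all simple. Hence `h g` has one sign and `∫ h g [p,
p'] ≠ 0`, whereas `h` is orthogonal to every function of index below `k₀`.

The Chebyshev bound comes from the system `u' = s w`, `w' = -lam r u` with positive periodic `r`,
`s`. Rolle's theorem applied twice carries the zeros of `∑ c_l u_l` to at least as many zeros of `∑
l c_l u_l`. After many iterations the largest eigenvalue dominates, and in the limit its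
eigenfunction inherits the zeros, which cannot merge because `u` and `w` have no common zero
(`CyclicZeros.exists_of_sum`). The monotone angle of `(u, w)` shows that index `k ≥ 1` means exactly
`2k` zeros, and Sturm separation extends this count to every eigenfunction of the same eigenvalue.
-/

namespace MinkowskiPlane

/-! ### Cyclic sequences of zeros -/

/-- `f` vanishes at the points of a cyclically ordered sequence with `N` members per period. -/
def CyclicZeros (f : ℝ → ℝ) (N : ℕ) : Prop :=
  ∃ t : ℕ → ℝ, (∀ i < N, t i < t (i + 1)) ∧ t N = t 0 + 2 * Real.pi ∧ ∀ i ≤ N, f (t i) = 0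

lemma CyclicZeros.pos {f : ℝ → ℝ} {N : ℕ} (h : CyclicZeros f N) : 0 < N := by
  obtain ⟨t, -, h2, -⟩ := h
  rcases Nat.eq_zero_or_pos N with rfl | h
  · linarith [Real.pi_pos]
  · exact h

lemma CyclicZeros.congr {f g : ℝ → ℝ} {N : ℕ} (h : CyclicZeros f N)
    (hfg : ∀ x, f x = 0 → g x = 0) : CyclicZeros g N := by
  obtain ⟨t, h1, h2, h3⟩ := h
  exact ⟨t, h1, h2, fun i hi => hfg _ (h3 i hi)⟩

/-- A cyclic sequence of `N` points has `N` gaps per period, so Rolle's theorem on a circle loses no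
zero, unlike on an interval. -/
lemma CyclicZeros.interlace {f g : ℝ → ℝ} {N : ℕ} (hg : Function.Periodic g (2 * Real.pi))
    (H : ∀ a b, a < b → f a = 0 → f b = 0 → ∃ x ∈ Set.Ioo a b, g x = 0)
    (h : CyclicZeros f N) : CyclicZeros g N := by
  have hN := h.pos
  obtain ⟨t, h1, h2, h3⟩ := h
  have key : ∀ i, ∃ x, i < N → x ∈ Set.Ioo (t i) (t (i + 1)) ∧ g x = 0 := by
    intro i
    by_cases hi : i < N
    · obtain ⟨x, hx, hx'⟩ := H _ _ (h1 i hi) (h3 i hi.le) (h3 (i + 1) hi)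
      exact ⟨x, fun _ => ⟨hx, hx'⟩⟩
    · exact ⟨0, fun h => absurd h hi⟩
  choose x hx using key
  refine ⟨fun i => if i < N then x i else x 0 + 2 * Real.pi, ?_, ?_, ?_⟩
  · intro i hi
    simp only [hi, if_true]
    split_ifs with hi'
    · exact (hx i hi).1.2.trans (hx (i + 1) hi').1.1
    · have : i + 1 = N := by omega
      have h4 := (hx i hi).1.2
      rw [this, h2] at h4
      linarith [(hx 0 hN).1.1]
  · simp [hN]
  · intro i hi
    dsimp only
    split_ifs with hi'
    · exact (hx i hi').2
    · rw [hg]; exact (hx 0 hN).2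

/-- A zero of `g` at the starting point of the sequence is counted in addition. -/
lemma CyclicZeros.interlace_succ {f g : ℝ → ℝ} {N : ℕ} {t : ℕ → ℝ} (hN : 0 < N)
    (h1 : ∀ i < N, t i < t (i + 1)) (h2 : t N = t 0 + 2 * Real.pi) (h3 : ∀ i ≤ N, f (t i) = 0)
    (hg : Function.Periodic g (2 * Real.pi))
    (H : ∀ a b, a < b → f a = 0 → f b = 0 → ∃ x ∈ Set.Ioo a b, g x = 0)
    (h0 : g (t 0) = 0) : CyclicZeros g (N + 1) := by
  have key : ∀ i, ∃ x, i < N → x ∈ Set.Ioo (t i) (t (i + 1)) ∧ g x = 0 := by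
    intro i
    by_cases hi : i < N
    · obtain ⟨x, hx, hx'⟩ := H _ _ (h1 i hi) (h3 i hi.le) (h3 (i + 1) hi)
      exact ⟨x, fun _ => ⟨hx, hx'⟩⟩
    · exact ⟨0, fun h => absurd h hi⟩
  choose x hx using key
  -- The new sequence is `t 0, x 0, …, x (N - 1), t 0 + 2π`: one zero in each gap, plus the common
  -- one.
  refine ⟨fun i => if i = 0 then t 0 else if i ≤ N then x (i - 1) else t 0 + 2 * Real.pi,
    ?_, ?_, ?_⟩
  · intro i hi
    rcases i with _ | i
    · simp only [if_true, zero_add, one_ne_zero, if_false, Nat.succ_le_iff.mpr hN, Nat.sub_self]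
      exact (hx 0 hN).1.1
    · have hi' : i + 1 ≤ N := by omega
      simp only [Nat.add_eq_zero_iff, one_ne_zero, and_false, if_false, hi', if_true,
        Nat.add_sub_cancel]
      split_ifs with hi''
      · exact (hx i (by omega)).1.2.trans (hx (i + 1) (by omega)).1.1
      · have : i + 1 = N := by omega
        have h4 := (hx i (by omega)).1.2
        rwa [this, h2] at h4
  · simp
  · intro i hi
    dsimp only
    split_ifs with h4 h5
    · exact h0
    · exact (hx (i - 1) (by omega)).2
    · rw [hg]; exact h0

/-- Reduction modulo the period moves `T` into `[a, a + 2π)`, where it is sorted. The freedom to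
start at a prescribed `a` serves to count a double zero at `a` twice. -/
lemma exists_sorted_zeros {f : ℝ → ℝ} (hf : Function.Periodic f (2 * Real.pi)) (T : Finset ℝ)
    (hT : ∀ x ∈ T, x ∈ Set.Ico 0 (2 * Real.pi)) (hz : ∀ x ∈ T, f x = 0) {a : ℝ} (ha : a ∈ T) :
    ∃ t : ℕ → ℝ, t 0 = a ∧ (∀ i < T.card, t i < t (i + 1)) ∧
      t T.card = t 0 + 2 * Real.pi ∧ ∀ i ≤ T.card, f (t i) = 0 := by
  have hpi : 0 < 2 * Real.pi := Real.two_pi_pos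
  set T' := T.image (toIcoMod hpi a) with hT'
  have hinj : Set.InjOn (toIcoMod hpi a) T := by
    intro x hx y hy hxy
    have h1 : toIcoMod hpi 0 x = x := (toIcoMod_eq_self hpi).2 (by simpa using hT x hx)
    have h2 : toIcoMod hpi 0 y = y := (toIcoMod_eq_self hpi).2 (by simpa using hT y hy)
    rw [← h1, ← h2, ← toIcoMod_toIcoMod hpi 0 a x, hxy, toIcoMod_toIcoMod]
  have hcard : T'.card = T.card := Finset.card_image_of_injOn hinj
  have haT : a ∈ T' := Finset.mem_image.2 ⟨a, ha, toIcoMod_apply_left hpi a⟩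
  have hmem : ∀ x ∈ T', a ≤ x ∧ x < a + 2 * Real.pi ∧ f x = 0 := by
    intro x hx
    obtain ⟨y, hy, rfl⟩ := Finset.mem_image.1 hx
    refine ⟨left_le_toIcoMod hpi a y, toIcoMod_lt_right hpi a y, ?_⟩
    rw [toIcoMod, hf.sub_zsmul_eq]
    exact hz y hy
  have hpos : 0 < T.card := Finset.card_pos.2 ⟨a, ha⟩
  set o := T'.orderEmbOfFin hcard
  have ho : ∀ j, o j ∈ T' := fun j => T'.orderEmbOfFin_mem hcard j
  have h0 : o ⟨0, hpos⟩ = a := by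
    have : a ∈ Set.range o := by rw [Finset.range_orderEmbOfFin]; exact haT
    obtain ⟨j, hj⟩ := this
    refine le_antisymm ?_ (hmem _ (ho _)).1
    rw [← hj]
    exact o.monotone (Fin.mk_le_of_le_val (Nat.zero_le _))
  refine ⟨fun i => if h : i < T.card then o ⟨i, h⟩ else a + 2 * Real.pi, ?_, ?_, ?_, ?_⟩
  · simp [hpos, h0]
  · intro i hi
    simp only [hi, dif_pos]
    split_ifs with h
    · exact o.strictMono (by simp [Fin.lt_def])
    · exact (hmem _ (ho _)).2.1
  · simp [hpos, h0]
  · intro i hi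
    dsimp only
    split_ifs with h
    · exact (hmem _ (ho _)).2.2
    · rw [hf]; exact hz a ha

lemma cyclicZeros_of_finset {f : ℝ → ℝ} (hf : Function.Periodic f (2 * Real.pi)) (T : Finset ℝ)
    (hT : ∀ x ∈ T, x ∈ Set.Ico 0 (2 * Real.pi)) (hz : ∀ x ∈ T, f x = 0) (hne : T.Nonempty) :
    CyclicZeros f T.card := by
  obtain ⟨a, ha⟩ := hne
  obtain ⟨t, -, h1, h2, h3⟩ := exists_sorted_zeros hf T hT hz ha
  exact ⟨t, h1, h2, h3⟩

/-- The zeros can be taken to start in `[0, 2π]`. -/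
lemma CyclicZeros.exists_normalized {f : ℝ → ℝ} (hf : Function.Periodic f (2 * Real.pi)) {N : ℕ}
    (h : CyclicZeros f N) : ∃ t : ℕ → ℝ, (∀ i < N, t i < t (i + 1)) ∧
      t N = t 0 + 2 * Real.pi ∧ (∀ i ≤ N, f (t i) = 0) ∧
      ∀ i, t i ∈ Set.Icc 0 (4 * Real.pi) := by
  have hpi : 0 < 2 * Real.pi := Real.two_pi_pos
  have hN := h.pos
  obtain ⟨t, h1, h2, h3⟩ := h
  set n := toIcoDiv hpi 0 (t 0) with hn
  have h0 : t 0 - n • (2 * Real.pi) ∈ Set.Ico 0 (0 + 2 * Real.pi) :=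
    sub_toIcoDiv_zsmul_mem_Ico hpi 0 (t 0)
  have mono : ∀ i j, i ≤ j → j ≤ N → t i ≤ t j := by
    intro i j hij
    induction j, hij using Nat.le_induction with
    | base => intro _; exact le_rfl
    | succ j hj ih => intro hjN; exact (ih (by omega)).trans (h1 j (by omega)).le
  -- Freezing the sequence after `N` keeps every term in one compact interval, as the later
  -- compactness argument needs.
  refine ⟨fun i => t (min i N) - n • (2 * Real.pi), ?_, ?_, ?_, ?_⟩
  · intro i hi
    have e1 : min i N = i := by omega
    have e2 : min (i + 1) N = i + 1 := by omega
    simp only [e1, e2]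
    linarith [h1 i hi]
  · simp [h2]; ring
  · intro i hi
    rw [hf.sub_zsmul_eq]
    exact h3 _ (by omega)
  · intro i
    have a1 := mono 0 (min i N) (by omega) (by omega)
    have a2 := mono (min i N) N (by omega) (by omega)
    obtain ⟨b1, b2⟩ := h0
    constructor <;> dsimp only <;> linarith

/-! ### The first-order periodic system -/

/-- Continuous positive `2π`-periodic coefficients of the system `u' = s w`, `w' = -lam r u`. -/
structure IsCoeff (r s : ℝ → ℝ) : Prop where
  cont_r : Continuous r
  cont_s : Continuous s
  pos_r : ∀ x, 0 < r x
  pos_s : ∀ x, 0 < s x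
  per_r : Function.Periodic r (2 * Real.pi)
  per_s : Function.Periodic s (2 * Real.pi)

/-- `(u, w)` is a `2π`-periodic solution of the system `u' = s w`, `w' = -lam r u`. -/
structure IsPeriodicSolution (r s : ℝ → ℝ) (lam : ℝ) (u w : ℝ → ℝ) : Prop where
  deriv_u : ∀ x, HasDerivAt u (s x * w x) x
  deriv_w : ∀ x, HasDerivAt w (-lam * r x * u x) x
  per_u : Function.Periodic u (2 * Real.pi)
  per_w : Function.Periodic w (2 * Real.pi)

namespace IsPeriodicSolution

variable {r s : ℝ → ℝ} {lam mu : ℝ} {u w u₁ w₁ u₂ w₂ : ℝ → ℝ}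

lemma cont_u (h : IsPeriodicSolution r s lam u w) : Continuous u :=
  continuous_iff_continuousAt.2 fun x => (h.deriv_u x).continuousAt

lemma cont_w (h : IsPeriodicSolution r s lam u w) : Continuous w :=
  continuous_iff_continuousAt.2 fun x => (h.deriv_w x).continuousAt

lemma sum {ι : Type*} (S : Finset ι) (c : ι → ℝ) {U W : ι → ℝ → ℝ}
    (h : ∀ i ∈ S, IsPeriodicSolution r s lam (U i) (W i)) :
    IsPeriodicSolution r s lam (fun x => ∑ i ∈ S, c i * U i x) (fun x => ∑ i ∈ S, c i * W i x) where
  deriv_u x := by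
    have := HasDerivAt.fun_sum (u := S) fun i hi => ((h i hi).deriv_u x).const_mul (c i)
    refine this.congr_deriv ?_
    rw [Finset.mul_sum]
    exact Finset.sum_congr rfl fun i _ => by ring
  deriv_w x := by
    have := HasDerivAt.fun_sum (u := S) fun i hi => ((h i hi).deriv_w x).const_mul (c i)
    refine this.congr_deriv ?_
    rw [Finset.mul_sum]
    exact Finset.sum_congr rfl fun i _ => by ring
  per_u x := Finset.sum_congr rfl fun i hi => by rw [(h i hi).per_u]
  per_w x := Finset.sum_congr rfl fun i hi => by rw [(h i hi).per_w]

lemma sub_smul (h₁ : IsPeriodicSolution r s lam u₁ w₁) (h₂ : IsPeriodicSolution r s lam u₂ w₂)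
    (c : ℝ) : IsPeriodicSolution r s lam (fun x => u₁ x - c * u₂ x) (fun x => w₁ x - c * w₂ x) where
  deriv_u x := ((h₁.deriv_u x).sub ((h₂.deriv_u x).const_mul c)).congr_deriv (by ring)
  deriv_w x := ((h₁.deriv_w x).sub ((h₂.deriv_w x).const_mul c)).congr_deriv (by ring)
  per_u x := by simp only [h₁.per_u x, h₂.per_u x]
  per_w x := by simp only [h₁.per_w x, h₂.per_w x]

/-- Uniqueness for the initial value problem. -/
lemma eq_zero (hc : IsCoeff r s) (h : IsPeriodicSolution r s lam u w) {t : ℝ} (hu : u t = 0)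
    (hw : w t = 0) (x : ℝ) : u x = 0 := by
  obtain ⟨C, hC⟩ : ∃ C, ∀ x, |s x - lam * r x| ≤ C := by
    have hper : Function.Periodic (fun x => |s x - lam * r x|) (2 * Real.pi) := fun x => by
      simp only [hc.per_r x, hc.per_s x]
    have hcont : Continuous fun x => |s x - lam * r x| :=
      (hc.cont_s.sub (continuous_const.mul hc.cont_r)).abs
    obtain ⟨C, hC⟩ := (hper.compact_of_continuous Real.two_pi_pos.ne' hcont).bddAbove
    exact ⟨C, fun x => hC ⟨x, rfl⟩⟩
  -- Grönwall's argument for the energy `u² + w²`, whose derivative is at most `C` times itself in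
  -- absolute value.
  have hE : ∀ x, HasDerivAt (fun x => u x ^ 2 + w x ^ 2)
      (2 * (u x * w x) * (s x - lam * r x)) x := fun x =>
    (((h.deriv_u x).pow 2).add ((h.deriv_w x).pow 2)).congr_deriv (by simp; ring)
  have hb : ∀ x, |2 * (u x * w x) * (s x - lam * r x)| ≤ C * (u x ^ 2 + w x ^ 2) := by
    intro x
    rw [abs_mul, mul_comm C]
    refine mul_le_mul ?_ (hC x) (abs_nonneg _) (by positivity)
    rw [abs_le]
    constructor <;> nlinarith [sq_nonneg (u x + w x), sq_nonneg (u x - w x)]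
  have hexp : ∀ (k x : ℝ), HasDerivAt (fun x => (u x ^ 2 + w x ^ 2) * Real.exp (k * x))
      ((2 * (u x * w x) * (s x - lam * r x) + k * (u x ^ 2 + w x ^ 2)) * Real.exp (k * x)) x := by
    intro k x
    have h2 : HasDerivAt (fun x => Real.exp (k * x)) (Real.exp (k * x) * (k * 1)) x :=
      ((hasDerivAt_id x).const_mul k).exp
    exact ((hE x).mul h2).congr_deriv (by ring)
  have key : ∃ k, (u x ^ 2 + w x ^ 2) * Real.exp (k * x) ≤ 0 := by
    rcases le_total t x with htx | htx
    · have hanti : Antitone fun x => (u x ^ 2 + w x ^ 2) * Real.exp (-C * x) :=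
        antitone_of_hasDerivAt_nonpos (hexp (-C)) fun x =>
          mul_nonpos_of_nonpos_of_nonneg (by linarith [(abs_le.1 (hb x)).2]) (Real.exp_pos _).le
      exact ⟨-C, by simpa [hu, hw] using hanti htx⟩
    · have hmono : Monotone fun x => (u x ^ 2 + w x ^ 2) * Real.exp (C * x) :=
        monotone_of_hasDerivAt_nonneg (hexp C) fun x =>
          mul_nonneg (by linarith [(abs_le.1 (hb x)).1]) (Real.exp_pos _).le
      exact ⟨C, by simpa [hu, hw] using hmono htx⟩
  obtain ⟨k, hk⟩ := key
  have := nonpos_of_mul_nonpos_left hk (Real.exp_pos _)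
  nlinarith [sq_nonneg (u x), sq_nonneg (w x)]

lemma w_ne_zero (hc : IsCoeff r s) (h : IsPeriodicSolution r s lam u w) (hne : u ≠ 0) {t : ℝ}
    (hu : u t = 0) : w t ≠ 0 := fun hw => hne (funext fun x => h.eq_zero hc hu hw x)

/-- Eigenfunctions with different eigenvalues are orthogonal. -/
lemma integral_mul_eq_zero (hc : IsCoeff r s) (h₁ : IsPeriodicSolution r s lam u₁ w₁)
    (h₂ : IsPeriodicSolution r s mu u₂ w₂) (hne : lam ≠ mu) :
    ∫ x in (0 : ℝ)..(2 * Real.pi), u₁ x * u₂ x * r x = 0 := by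
  -- Lagrange's identity: the Wronskian is periodic, so its derivative has integral zero.
  have hd : ∀ x, HasDerivAt (fun x => u₁ x * w₂ x - u₂ x * w₁ x)
      ((lam - mu) * (u₁ x * u₂ x * r x)) x := fun x =>
    (((h₁.deriv_u x).mul (h₂.deriv_w x)).sub ((h₂.deriv_u x).mul (h₁.deriv_w x))).congr_deriv
      (by ring)
  have hcont : Continuous fun x => (lam - mu) * (u₁ x * u₂ x * r x) :=
    continuous_const.mul ((h₁.cont_u.mul h₂.cont_u).mul hc.cont_r)
  have := intervalIntegral.integral_eq_sub_of_hasDerivAt (a := 0) (b := 2 * Real.pi)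
    (fun x _ => hd x) (hcont.intervalIntegrable _ _)
  rw [intervalIntegral.integral_const_mul] at this
  have e : ∀ {f : ℝ → ℝ}, Function.Periodic f (2 * Real.pi) → f (2 * Real.pi) = f 0 := fun hf => by
    simpa using hf 0
  rw [e h₁.per_u, e h₂.per_u, e h₁.per_w, e h₂.per_w, sub_self] at this
  exact (mul_eq_zero.1 this).resolve_left (sub_ne_zero.2 hne)

end IsPeriodicSolution

lemma eq_zero_of_integral_eq_zero {f : ℝ → ℝ} (hf : Continuous f)
    (hper : Function.Periodic f (2 * Real.pi)) (h0 : ∀ x, 0 ≤ f x)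
    (hint : ∫ x in (0 : ℝ)..(2 * Real.pi), f x = 0) (x : ℝ) : f x = 0 := by
  by_contra hx
  obtain ⟨y, hy, hxy⟩ := hper.exists_mem_Ico₀ Real.two_pi_pos x
  have := intervalIntegral.integral_pos Real.two_pi_pos hf.continuousOn (fun x _ => h0 x)
    ⟨y, ⟨hy.1, hy.2.le⟩, (h0 y).lt_of_ne (by rw [← hxy]; exact fun h => hx h.symm)⟩
  exact this.ne' hint

namespace IsPeriodicSolution

variable {r s : ℝ → ℝ} {lam mu : ℝ} {u w u₁ w₁ u₂ w₂ : ℝ → ℝ}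

/-- The integrand is the derivative of the periodic function `u w`, and for `lam ≤ 0` it is
nonnegative. This excludes negative eigenvalues and makes eigenfunctions of eigenvalue `0` constant.
-/
lemma energy_eq_zero (hc : IsCoeff r s) (h : IsPeriodicSolution r s lam u w) (hlam : lam ≤ 0)
    (x : ℝ) : s x * w x ^ 2 - lam * r x * u x ^ 2 = 0 := by
  have hd : ∀ x, HasDerivAt (fun x => u x * w x) (s x * w x ^ 2 - lam * r x * u x ^ 2) x :=
    fun x => ((h.deriv_u x).mul (h.deriv_w x)).congr_deriv (by ring)
  have hcont : Continuous fun x => s x * w x ^ 2 - lam * r x * u x ^ 2 :=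
    (hc.cont_s.mul (h.cont_w.pow 2)).sub ((continuous_const.mul hc.cont_r).mul (h.cont_u.pow 2))
  refine eq_zero_of_integral_eq_zero hcont ?_ ?_ ?_ x
  · intro x
    simp only [hc.per_r x, hc.per_s x, h.per_u x, h.per_w x]
  · intro x
    have h1 := mul_nonneg (hc.pos_s x).le (sq_nonneg (w x))
    have h2 := mul_nonneg (mul_nonneg (neg_nonneg.2 hlam) (hc.pos_r x).le) (sq_nonneg (u x))
    linarith
  · rw [intervalIntegral.integral_eq_sub_of_hasDerivAt (fun x _ => hd x)
      (hcont.intervalIntegrable _ _)]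
    have hu : u (2 * Real.pi) = u 0 := by simpa using h.per_u 0
    have hw : w (2 * Real.pi) = w 0 := by simpa using h.per_w 0
    rw [hu, hw, sub_self]

lemma eigenvalue_nonneg (hc : IsCoeff r s) (h : IsPeriodicSolution r s lam u w) (hne : u ≠ 0) :
    0 ≤ lam := by
  by_contra! hlam
  refine hne (funext fun x => ?_)
  have h0 := h.energy_eq_zero hc hlam.le x
  have h1 := mul_nonneg (hc.pos_s x).le (sq_nonneg (w x))
  have h2 := mul_pos (neg_pos.2 hlam) (hc.pos_r x)
  have h3 : u x ^ 2 = 0 := by nlinarith [sq_nonneg (u x)]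
  simpa using h3

lemma w_eq_zero_of_eigenvalue_zero (hc : IsCoeff r s) (h : IsPeriodicSolution r s 0 u w) (x : ℝ) :
    w x = 0 := by
  have h0 := h.energy_eq_zero hc le_rfl x
  have h1 := (hc.pos_s x).ne'
  simpa [h1] using h0

/-- Sturm separation: eigenfunctions of the same eigenvalue have equally many zeros. -/
lemma cyclicZeros_of_same_eigenvalue (hc : IsCoeff r s) (h₁ : IsPeriodicSolution r s lam u₁ w₁)
    (h₂ : IsPeriodicSolution r s lam u₂ w₂) (hne₁ : u₁ ≠ 0) {N : ℕ}
    (hz : CyclicZeros u₁ N) : CyclicZeros u₂ N := by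
  have hW : ∀ x, HasDerivAt (fun x => u₁ x * w₂ x - u₂ x * w₁ x) 0 x := fun x =>
    (((h₁.deriv_u x).mul (h₂.deriv_w x)).sub ((h₂.deriv_u x).mul (h₁.deriv_w x))).congr_deriv
      (by ring)
  have hconst : ∀ x y, u₁ x * w₂ x - u₂ x * w₁ x = u₁ y * w₂ y - u₂ y * w₁ y := fun x y =>
    is_const_of_deriv_eq_zero (f := fun x => u₁ x * w₂ x - u₂ x * w₁ x)
      (fun x => (hW x).differentiableAt) (fun x => (hW x).deriv) x y
  -- A common zero makes the two solutions proportional, by uniqueness for the initial value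
  -- problem.
  by_cases hW0 : ∃ t, u₁ t = 0 ∧ u₂ t = 0
  · obtain ⟨t, ht₁, ht₂⟩ := hW0
    have hw := h₁.w_ne_zero hc hne₁ ht₁
    have h3 := (h₂.sub_smul h₁ (w₂ t / w₁ t)).eq_zero hc (t := t)
      (by simp [ht₁, ht₂]) (by field_simp; ring)
    exact hz.congr fun x hx => by simpa [hx] using h3 x
  push Not at hW0
  refine hz.interlace h₂.per_u fun a b hab ha hb => ?_
  by_contra! hno
  have hno' : ∀ x ∈ Set.Icc a b, u₂ x ≠ 0 := by
    intro x hx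
    rcases eq_or_lt_of_le hx.1 with rfl | hx1
    · exact hW0 _ ha
    rcases eq_or_lt_of_le hx.2 with rfl | hx2
    · exact hW0 _ hb
    exact hno x ⟨hx1, hx2⟩
  -- Rolle for `u₁ / u₂`, whose derivative is `-s / u₂²` times the constant Wronskian; that constant
  -- is nonzero at `a`.
  obtain ⟨x, hx, hx0⟩ := exists_hasDerivAt_eq_zero (f := fun x => u₁ x / u₂ x)
    (f' := fun x => (s x * w₁ x * u₂ x - u₁ x * (s x * w₂ x)) / u₂ x ^ 2) hab
    (h₁.cont_u.continuousOn.div h₂.cont_u.continuousOn hno') (by simp [ha, hb])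
    fun x hx => (h₁.deriv_u x).div (h₂.deriv_u x) (hno x hx)
  have h4 : s x * (u₁ x * w₂ x - u₂ x * w₁ x) = 0 := by
    have := (div_eq_zero_iff.1 hx0).resolve_right (pow_ne_zero 2 (hno x hx))
    linarith
  have h5 := (mul_eq_zero.1 h4).resolve_left (hc.pos_s x).ne'
  rw [hconst x a, ha, zero_mul, zero_sub, neg_eq_zero] at h5
  exact mul_ne_zero (hW0 _ ha) (h₁.w_ne_zero hc hne₁ ha) h5

end IsPeriodicSolution

/-! ### Sturm's upper bound by iterated Rolle -/

section Sturm

variable {r s : ℝ → ℝ} {S : Finset ℝ} {u w : ℝ → ℝ → ℝ}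

lemma hasDerivAt_sum_u (h : ∀ l ∈ S, IsPeriodicSolution r s l (u l) (w l)) (c : ℝ → ℝ) (x : ℝ) :
    HasDerivAt (fun x => ∑ l ∈ S, c l * u l x) (s x * ∑ l ∈ S, c l * w l x) x := by
  have := HasDerivAt.fun_sum (u := S) fun i hi => ((h i hi).deriv_u x).const_mul (c i)
  refine this.congr_deriv ?_
  rw [Finset.mul_sum]
  exact Finset.sum_congr rfl fun i _ => by ring

lemma hasDerivAt_sum_w (h : ∀ l ∈ S, IsPeriodicSolution r s l (u l) (w l)) (c : ℝ → ℝ) (x : ℝ) :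
    HasDerivAt (fun x => ∑ l ∈ S, c l * w l x) (-r x * ∑ l ∈ S, l * c l * u l x) x := by
  have := HasDerivAt.fun_sum (u := S) fun i hi => ((h i hi).deriv_w x).const_mul (c i)
  refine this.congr_deriv ?_
  rw [Finset.mul_sum]
  exact Finset.sum_congr rfl fun i _ => by ring

/-- Rolle's theorem for a quotient `f' / k` of a derivative. -/
lemma exists_zero_of_hasDerivAt_mul {f g k : ℝ → ℝ} (hf : ∀ x, HasDerivAt f (k x * g x) x)
    (hk : ∀ x, k x ≠ 0) {a b : ℝ} (hab : a < b) (ha : f a = 0) (hb : f b = 0) :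
    ∃ x ∈ Set.Ioo a b, g x = 0 := by
  obtain ⟨x, hx, hx0⟩ := exists_hasDerivAt_eq_zero hab
    (fun x _ => (hf x).continuousAt.continuousWithinAt) (ha.trans hb.symm) fun x _ => hf x
  exact ⟨x, hx, (mul_eq_zero.1 hx0).resolve_left (hk x)⟩

lemma CyclicZeros.sum_w_to_u (hc : IsCoeff r s)
    (h : ∀ l ∈ S, IsPeriodicSolution r s l (u l) (w l)) (c : ℝ → ℝ) {N : ℕ}
    (hz : CyclicZeros (fun x => ∑ l ∈ S, c l * w l x) N) :
    CyclicZeros (fun x => ∑ l ∈ S, l * c l * u l x) N :=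
  hz.interlace (fun x => Finset.sum_congr rfl fun l hl => by rw [(h l hl).per_u])
    fun _ _ => exists_zero_of_hasDerivAt_mul (hasDerivAt_sum_w h c)
      fun x => (neg_neg_of_pos (hc.pos_r x)).ne

/-- One Rolle step passes from the `u l` to the `w l`, a second one back with an extra factor `l`.
Neither lowers the number of zeros. -/
lemma CyclicZeros.sum_iterate (hc : IsCoeff r s)
    (h : ∀ l ∈ S, IsPeriodicSolution r s l (u l) (w l)) {N : ℕ}
    (hz : CyclicZeros (fun x => ∑ l ∈ S, u l x) N) (n : ℕ) :
    CyclicZeros (fun x => ∑ l ∈ S, l ^ n * u l x) N := by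
  induction n with
  | zero => simpa using hz
  | succ n ih =>
    have h1 : CyclicZeros (fun x => ∑ l ∈ S, l ^ n * w l x) N :=
      ih.interlace (fun x => Finset.sum_congr rfl fun l hl => by rw [(h l hl).per_w])
        fun _ _ => exists_zero_of_hasDerivAt_mul (hasDerivAt_sum_u h _) fun x => (hc.pos_s x).ne'
    refine (h1.sum_w_to_u hc h).congr fun x hx => ?_
    simpa [pow_succ'] using hx

/-- Sturm's upper bound: a sum of eigenfunctions with distinct eigenvalues has at most as many zeros
as one of them (that of the largest eigenvalue). -/
theorem CyclicZeros.exists_of_sum (hc : IsCoeff r s)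
    (h : ∀ l ∈ S, IsPeriodicSolution r s l (u l) (w l)) (hne : ∀ l ∈ S, u l ≠ 0)
    (hS : S.Nonempty) {N : ℕ} (hz : CyclicZeros (fun x => ∑ l ∈ S, u l x) N) :
    ∃ l ∈ S, CyclicZeros (u l) N := by
  have hnn : ∀ l ∈ S, 0 ≤ l := fun l hl => (h l hl).eigenvalue_nonneg hc (hne l hl)
  set L := S.max' hS with hL
  have hLS : L ∈ S := S.max'_mem hS
  have hle : ∀ l ∈ S, l ≤ L := fun l hl => S.le_max' l hl
  refine ⟨L, hLS, ?_⟩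
  -- If the largest eigenvalue is `0`, nonnegativity leaves a single term and normalizing by `L` is
  -- unnecessary.
  rcases (hnn L hLS).eq_or_lt with hL0 | hLpos
  · have : S = {L} := Finset.eq_singleton_iff_unique_mem.2 ⟨hLS, fun l hl =>
      le_antisymm (hle l hl) (hL0 ▸ hnn l hl)⟩
    rw [this] at hz
    simpa using hz
  have hlim : ∀ l ∈ S, Tendsto (fun n : ℕ => (l / L) ^ n) atTop (𝓝 (if l = L then 1 else 0)) := by
    intro l hl
    split_ifs with hlL
    · simp [hlL, hLpos.ne']
    · exact tendsto_pow_atTop_nhds_zero_of_lt_one (div_nonneg (hnn l hl) hLpos.le)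
        ((div_lt_one hLpos).2 ((hle l hl).lt_of_ne hlL))
  -- After division by `L ^ n` only the term of `L` survives the limit, even at moving arguments.
  -- This is used for both `u` and `w`.
  have hsum : ∀ (v : ℝ → ℝ → ℝ), (∀ l ∈ S, Continuous (v l)) → ∀ (φ : ℕ → ℕ) (x : ℕ → ℝ) (y : ℝ),
      Tendsto φ atTop atTop → Tendsto x atTop (𝓝 y) →
      (∀ n, ∑ l ∈ S, (l / L) ^ φ n * v l (x n) = 0) → v L y = 0 := by
    intro v hv φ x y hφ hx h0
    have h1 : Tendsto (fun n => ∑ l ∈ S, (l / L) ^ φ n * v l (x n)) atTop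
        (𝓝 (∑ l ∈ S, (if l = L then 1 else 0) * v l y)) :=
      tendsto_finsetSum _ fun l hl =>
        ((hlim l hl).comp hφ).mul (((hv l hl).tendsto y).comp hx)
    simp only [h0] at h1
    have h2 := tendsto_nhds_unique h1 tendsto_const_nhds
    simpa [hLS] using h2
  have hzn : ∀ n : ℕ, CyclicZeros (fun x => ∑ l ∈ S, (l / L) ^ n * u l x) N := fun n =>
    (hz.sum_iterate hc h n).congr fun x hx => by
      have : ∑ l ∈ S, (l / L) ^ n * u l x = (L ^ n)⁻¹ * ∑ l ∈ S, l ^ n * u l x := by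
        rw [Finset.mul_sum]
        exact Finset.sum_congr rfl fun l _ => by rw [div_pow]; ring
      rw [this, hx, mul_zero]
  choose t ht1 ht2 ht3 ht4 using fun n => (hzn n).exists_normalized
    fun x => Finset.sum_congr rfl fun l hl => by rw [(h l hl).per_u]
  -- Compactness of the product gives one subsequence along which all zeros converge.
  have hcpt : IsCompact (Set.univ.pi fun _ : ℕ => Set.Icc (0 : ℝ) (4 * Real.pi)) :=
    isCompact_univ_pi fun _ => isCompact_Icc
  obtain ⟨τ, -, φ, hφ, hτ⟩ := hcpt.tendsto_subseq fun n => Set.mem_univ_pi.2 (ht4 n)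
  have hτi : ∀ i, Tendsto (fun n => t (φ n) i) atTop (𝓝 (τ i)) := fun i =>
    (tendsto_pi_nhds.1 hτ) i
  have hzero : ∀ i ≤ N, u L (τ i) = 0 := fun i hi =>
    hsum u (fun l hl => (h l hl).cont_u) φ _ _ hφ.tendsto_atTop (hτi i) fun n => ht3 (φ n) i hi
  refine ⟨τ, fun i hi => ?_, ?_, hzero⟩
  · have hle' : τ i ≤ τ (i + 1) :=
      le_of_tendsto_of_tendsto' (hτi i) (hτi (i + 1)) fun n => (ht1 _ i hi).le
    -- If two zeros merged, the zeros of the `w`-sum between them would converge to the same point,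
    -- and `u L`, `w L` would vanish there together.
    refine hle'.lt_of_ne fun heq => ?_
    have hR : ∀ n, ∃ x ∈ Set.Ioo (t (φ n) i) (t (φ n) (i + 1)),
        ∑ l ∈ S, (l / L) ^ φ n * w l x = 0 := fun n =>
      exists_zero_of_hasDerivAt_mul (hasDerivAt_sum_u h _) (fun x => (hc.pos_s x).ne')
        (ht1 _ i hi) (ht3 _ i hi.le) (ht3 _ (i + 1) hi)
    choose ξ hξ hξ0 using hR
    have hξlim : Tendsto ξ atTop (𝓝 (τ i)) :=
      tendsto_of_tendsto_of_tendsto_of_le_of_le (hτi i) (heq ▸ hτi (i + 1))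
        (fun n => (hξ n).1.le) fun n => (hξ n).2.le
    have hw := hsum w (fun l hl => (h l hl).cont_w) φ _ _ hφ.tendsto_atTop hξlim hξ0
    exact (h L hLS).w_ne_zero hc (hne L hLS) (hzero i hi.le) hw
  · refine tendsto_nhds_unique (hτi N) ?_
    simp only [ht2]
    exact (hτi 0).add_const _

end Sturm

/-! ### Rotation angle and number of zeros -/

section Angle

variable {r s : ℝ → ℝ} {lam : ℝ} {u w : ℝ → ℝ}

/-- A continuous choice `φ` of the clockwise angle of the curve `(u, w)`. -/
lemma IsPeriodicSolution.exists_angle (hc : IsCoeff r s) (h : IsPeriodicSolution r s lam u w)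
    (hne : u ≠ 0) (hlam : 0 < lam) :
    ∃ φ : ℝ → ℝ, StrictMono φ ∧ Continuous φ ∧ (∀ x, u x = 0 ↔ ∃ n : ℤ, φ x = n * Real.pi) ∧
      ∀ x, φ (x + 2 * Real.pi) = φ x + ∫ x in (0 : ℝ)..(2 * Real.pi),
        (w x * (s x * w x) - u x * (-lam * r x * u x)) / (u x ^ 2 + w x ^ 2) := by
  have hE : ∀ x, 0 < u x ^ 2 + w x ^ 2 := by
    intro x
    by_cases hu : u x = 0
    · have := h.w_ne_zero hc hne hu
      positivity
    · positivity
  set F : ℝ → ℝ := fun x => (w x * (s x * w x) - u x * (-lam * r x * u x)) / (u x ^ 2 + w x ^ 2)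
    with hF
  have hu := h.cont_u
  have hw := h.cont_w
  have hs := hc.cont_s
  have hr := hc.cont_r
  have hFc : Continuous F := by
    refine Continuous.div (by fun_prop) (by fun_prop) fun x => (hE x).ne'
  have hFpos : ∀ x, 0 < F x := by
    intro x
    refine div_pos ?_ (hE x)
    have e : w x * (s x * w x) - u x * (-lam * r x * u x)
        = s x * w x ^ 2 + lam * r x * u x ^ 2 := by ring
    rw [e]
    have h1 := hc.pos_s x
    have h2 := mul_pos hlam (hc.pos_r x)
    by_cases hu : u x = 0
    · have := h.w_ne_zero hc hne hu
      positivity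
    · positivity
  have hFper : Function.Periodic F (2 * Real.pi) := fun x => by
    simp only [hF, h.per_u x, h.per_w x, hc.per_r x, hc.per_s x]
  -- The initial angle makes `(u 0, w 0)` parallel to `(sin φ₀, cos φ₀)`, so increasing angles run
  -- clockwise.
  obtain ⟨φ₀, hφ₀⟩ : ∃ a, u 0 * Real.cos a - w 0 * Real.sin a = 0 := by
    refine ⟨Complex.arg ⟨w 0, u 0⟩, ?_⟩
    have hz : (⟨w 0, u 0⟩ : ℂ) ≠ 0 := by
      intro hz
      have h1 := congrArg Complex.re hz
      have h2 := congrArg Complex.im hz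
      simp only [Complex.zero_re, Complex.zero_im] at h1 h2
      have := hE 0
      simp [h1, h2] at this
    rw [Complex.cos_arg hz, Complex.sin_arg]
    ring
  set φ : ℝ → ℝ := fun x => φ₀ + ∫ t in (0 : ℝ)..x, F t with hφ
  have hφd : ∀ x, HasDerivAt φ (F x) x := fun x =>
    (hFc.integral_hasStrictDerivAt 0 x).hasDerivAt.const_add φ₀
  -- The quotient is the squared sine of the angle between `(u, w)` and `(sin φ, cos φ)`. Both
  -- directions rotate with speed `F`, so it stays constant.
  have hA : ∀ x, HasDerivAt
      (fun x => (u x * Real.cos (φ x) - w x * Real.sin (φ x)) ^ 2 / (u x ^ 2 + w x ^ 2)) 0 x := by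
    intro x
    have hcos := (Real.hasDerivAt_cos (φ x)).comp x (hφd x)
    have hsin := (Real.hasDerivAt_sin (φ x)).comp x (hφd x)
    have := ((((h.deriv_u x).mul hcos).sub ((h.deriv_w x).mul hsin)).pow 2).div
      (((h.deriv_u x).pow 2).add ((h.deriv_w x).pow 2)) (hE x).ne'
    refine this.congr_deriv ?_
    have hE' := (hE x).ne'
    simp only [hF, Function.comp, Pi.sub_apply, Pi.mul_apply, Pi.add_apply, Pi.pow_apply]
    field_simp
    ring
  have hA0 : ∀ x, u x * Real.cos (φ x) - w x * Real.sin (φ x) = 0 := by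
    intro x
    have := is_const_of_deriv_eq_zero
      (f := fun x => (u x * Real.cos (φ x) - w x * Real.sin (φ x)) ^ 2 / (u x ^ 2 + w x ^ 2))
      (fun x => (hA x).differentiableAt) (fun x => (hA x).deriv) x 0
    have h0 : φ 0 = φ₀ := by simp [hφ]
    simp only [h0, hφ₀] at this
    simpa [(hE x).ne'] using this
  refine ⟨φ, ?_, continuous_iff_continuousAt.2 fun x => (hφd x).continuousAt, ?_, ?_⟩
  · exact strictMono_of_hasDerivAt_pos hφd hFpos
  · intro x
    have h1 : u x = 0 ↔ Real.sin (φ x) = 0 := by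
      have h2 := hA0 x
      constructor
      · intro hu
        rw [hu, zero_mul, zero_sub, neg_eq_zero] at h2
        exact (mul_eq_zero.1 h2).resolve_left (h.w_ne_zero hc hne hu)
      · intro hs
        have hcos : Real.cos (φ x) ≠ 0 := fun hcos => by
          have := Real.sin_sq_add_cos_sq (φ x)
          simp [hs, hcos] at this
        rw [hs, mul_zero, sub_zero] at h2
        exact (mul_eq_zero.1 h2).resolve_right hcos
    rw [h1, Real.sin_eq_zero_iff]
    exact exists_congr fun n => eq_comm
  · intro x
    have h1 := hFper.intervalIntegral_add_eq 0 x
    rw [zero_add] at h1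
    rw [h1]
    simp only [hφ]
    rw [add_assoc, intervalIntegral.integral_add_adjacent_intervals
      (hFc.intervalIntegrable _ _) (hFc.intervalIntegrable _ _)]

/-- The angle is a multiple of `π` at each zero and strictly increasing, so it gains at least `π`
per gap, out of `2πk` in all. -/
lemma IsPeriodicSolution.cyclicZeros_le (hc : IsCoeff r s) (h : IsPeriodicSolution r s lam u w)
    (hne : u ≠ 0) (hlam : 0 < lam) {k : ℕ}
    (hk : ∫ x in (0 : ℝ)..(2 * Real.pi),
        (w x * (s x * w x) - u x * (-lam * r x * u x)) / (u x ^ 2 + w x ^ 2) = 2 * Real.pi * k)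
    {N : ℕ} (hz : CyclicZeros u N) : N ≤ 2 * k := by
  obtain ⟨φ, hmono, -, hzero, hper⟩ := h.exists_angle hc hne hlam
  rw [hk] at hper
  obtain ⟨t, h1, h2, h3⟩ := hz
  have key : ∀ i ≤ N, φ (t 0) + i * Real.pi ≤ φ (t i) := by
    intro i
    induction i with
    | zero => simp
    | succ i ih =>
      intro hi
      have h4 := ih (by omega)
      obtain ⟨n, hn⟩ := (hzero _).1 (h3 i (by omega))
      obtain ⟨m, hm⟩ := (hzero _).1 (h3 (i + 1) hi)
      have h5 := hmono (h1 i hi)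
      rw [hn, hm] at h5
      have h6 : n < m := by exact_mod_cast lt_of_mul_lt_mul_right h5 Real.pi_pos.le
      have h7 : (n : ℝ) + 1 ≤ m := by exact_mod_cast h6
      rw [hm]
      rw [hn] at h4
      push_cast
      nlinarith [Real.pi_pos]
  have h4 := key N le_rfl
  rw [h2, hper] at h4
  have h5 : (N : ℝ) * Real.pi ≤ (2 * k : ℝ) * Real.pi := by linarith
  exact_mod_cast le_of_mul_le_mul_right h5 Real.pi_pos

lemma IsPeriodicSolution.cyclicZeros_two_mul (hc : IsCoeff r s)
    (h : IsPeriodicSolution r s lam u w) (hne : u ≠ 0) (hlam : 0 < lam) {k : ℕ} (hk1 : 1 ≤ k)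
    (hk : ∫ x in (0 : ℝ)..(2 * Real.pi),
        (w x * (s x * w x) - u x * (-lam * r x * u x)) / (u x ^ 2 + w x ^ 2) = 2 * Real.pi * k) :
    CyclicZeros u (2 * k) := by
  obtain ⟨φ, hmono, hcont, hzero, hper⟩ := h.exists_angle hc hne hlam
  rw [hk] at hper
  have hk1' : (1 : ℝ) ≤ k := by exact_mod_cast hk1
  have hpi := Real.pi_pos
  have ivt : ∀ a y, φ a ≤ y → y ≤ φ a + 2 * Real.pi * k → ∃ x, φ x = y := by
    intro a y h1 h2
    rw [← hper] at h2
    obtain ⟨x, -, hx⟩ := intermediate_value_Icc (by linarith : a ≤ a + 2 * Real.pi)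
      hcont.continuousOn ⟨h1, h2⟩
    exact ⟨x, hx⟩
  -- The first multiple of `π` not below `φ 0`; starting where it is attained, the angle meets `2k +
  -- 1` consecutive multiples, both ends included, within one period.
  set m : ℤ := ⌈φ 0 / Real.pi⌉
  have hm1 : φ 0 ≤ m * Real.pi := (div_le_iff₀ hpi).1 (Int.le_ceil _)
  have hm2 : m * Real.pi < φ 0 + Real.pi := by
    have := Int.ceil_lt_add_one (φ 0 / Real.pi)
    calc m * Real.pi < (φ 0 / Real.pi + 1) * Real.pi := mul_lt_mul_of_pos_right this hpi
      _ = φ 0 + Real.pi := by field_simp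
  obtain ⟨a, ha⟩ := ivt 0 (m * Real.pi) hm1 (by nlinarith)
  have hsel : ∀ i : ℕ, ∃ x, i ≤ 2 * k → φ x = m * Real.pi + i * Real.pi := by
    intro i
    by_cases hi : i ≤ 2 * k
    · have hi' : (i : ℝ) ≤ 2 * k := by exact_mod_cast hi
      obtain ⟨x, hx⟩ := ivt a (m * Real.pi + i * Real.pi)
        (by rw [ha]; nlinarith [i.cast_nonneg (α := ℝ)]) (by rw [ha]; nlinarith)
      exact ⟨x, fun _ => hx⟩
    · exact ⟨0, fun h => absurd h hi⟩
  choose t ht using hsel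
  refine ⟨t, fun i hi => ?_, ?_, fun i hi => ?_⟩
  · rw [← hmono.lt_iff_lt, ht i hi.le, ht (i + 1) hi]
    push_cast
    linarith
  · apply hmono.injective
    rw [hper, ht _ le_rfl, ht 0 (Nat.zero_le _)]
    push_cast
    ring
  · exact (hzero _).2 ⟨m + i, by rw [ht i hi]; push_cast; ring⟩

end Angle

/-! ### Chebyshev property of orthogonal families -/

section Chebyshev

lemma exists_ne_zero_vanishing {ι : Type*} [Fintype ι] (E : ι → ℝ → ℝ) (T : Finset ℝ)
    (hT : T.card < Fintype.card ι) : ∃ c : ι → ℝ, c ≠ 0 ∧ ∀ t ∈ T, ∑ i, c i * E i t = 0 := by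
  let f : (ι → ℝ) →ₗ[ℝ] (T → ℝ) :=
    { toFun := fun c t => ∑ i, c i * E i t
      map_add' := fun c d => by ext t; simp [add_mul, Finset.sum_add_distrib]
      map_smul' := fun a c => by ext t; simp [mul_assoc, Finset.mul_sum] }
  have hker : LinearMap.ker f ≠ ⊥ := LinearMap.ker_ne_bot_of_finrank_lt (by simpa using hT)
  obtain ⟨c, hc, hc0⟩ := (Submodule.ne_bot_iff _).1 hker
  exact ⟨c, hc0, fun t ht => congrFun (LinearMap.mem_ker.1 hc) ⟨t, ht⟩⟩

variable {ι : Type*} {r s : ℝ → ℝ} {lam : ι → ℝ} {E W : ι → ℝ → ℝ}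

/-- A finite family of periodic solutions, orthogonal for the weight `r`. -/
structure IsOrthogonalFamily (r s : ℝ → ℝ) (lam : ι → ℝ) (E W : ι → ℝ → ℝ) : Prop where
  sol : ∀ i, IsPeriodicSolution r s (lam i) (E i) (W i)
  orth : ∀ i j, i ≠ j → ∫ x in (0 : ℝ)..(2 * Real.pi), E i x * E j x * r x = 0
  ne_zero : ∀ i, E i ≠ 0

lemma IsOrthogonalFamily.linearIndependent (hc : IsCoeff r s)
    (h : IsOrthogonalFamily r s lam E W) {J : Finset ι} {c : ι → ℝ}
    (h0 : ∀ x, ∑ i ∈ J, c i * E i x = 0) {j : ι} (hj : j ∈ J) : c j = 0 := by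
  have hcont : ∀ i, Continuous fun x => E i x * E j x * r x := fun i =>
    ((h.sol i).cont_u.mul (h.sol j).cont_u).mul hc.cont_r
  have h1 : ∫ x in (0 : ℝ)..(2 * Real.pi), ∑ i ∈ J, c i * (E i x * E j x * r x) = 0 := by
    have : ∀ x, ∑ i ∈ J, c i * (E i x * E j x * r x) = 0 := fun x => by
      have : ∑ i ∈ J, c i * (E i x * E j x * r x) = (∑ i ∈ J, c i * E i x) * (E j x * r x) := by
        rw [Finset.sum_mul]
        exact Finset.sum_congr rfl fun i _ => by ring
      rw [this, h0, zero_mul]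
    simp [this]
  have hcont' : ∀ i, Continuous fun x => c i * (E i x * E j x * r x) := fun i =>
    continuous_const.mul (hcont i)
  rw [intervalIntegral.integral_finsetSum fun i _ => (hcont' i).intervalIntegrable _ _] at h1
  simp only [intervalIntegral.integral_const_mul] at h1
  rw [Finset.sum_eq_single j (fun i _ hij => by rw [h.orth i j hij, mul_zero])
    (fun hj' => absurd hj hj')] at h1
  refine (mul_eq_zero.1 h1).resolve_right fun h2 => h.ne_zero j (funext fun x => ?_)
  have := eq_zero_of_integral_eq_zero (hcont j)
    (fun x => by simp only [(h.sol j).per_u x, hc.per_r x])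
    (fun x => mul_nonneg (mul_self_nonneg _) (hc.pos_r x).le) h2 x
  simpa [(hc.pos_r x).ne'] using this

variable [Fintype ι]

/-- A nontrivial linear combination has at most `M` zeros if all members with the same
eigenvalues do. -/
lemma IsOrthogonalFamily.cyclicZeros_le (hc : IsCoeff r s)
    (h : IsOrthogonalFamily r s lam E W) {M : ℕ} (hM : ∀ i N, CyclicZeros (E i) N → N ≤ M)
    {c : ι → ℝ} (hc0 : c ≠ 0) {N : ℕ} (hz : CyclicZeros (fun x => ∑ i, c i * E i x) N) :
    N ≤ M := by
  classical
  -- Sturm's bound requires distinct eigenvalues, so terms of equal eigenvalue are grouped. Dropping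
  -- zero coefficients first makes every group a nonzero eigenfunction, by linear independence.
  set J : Finset ι := Finset.univ.filter fun i => c i ≠ 0 with hJ
  set u : ℝ → ℝ → ℝ := fun l x => ∑ i ∈ J with lam i = l, c i * E i x
  set w : ℝ → ℝ → ℝ := fun l x => ∑ i ∈ J with lam i = l, c i * W i x
  have hsol : ∀ l ∈ J.image lam, IsPeriodicSolution r s l (u l) (w l) := fun l _ =>
    IsPeriodicSolution.sum _ c fun i hi => by
      rw [← (Finset.mem_filter.1 hi).2]; exact h.sol i
  have hJne : J.Nonempty := by
    obtain ⟨i, hi⟩ := Function.ne_iff.1 hc0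
    exact ⟨i, by simpa [hJ] using hi⟩
  have hne : ∀ l ∈ J.image lam, u l ≠ 0 := by
    intro l hl hu
    obtain ⟨i, hi, rfl⟩ := Finset.mem_image.1 hl
    have := h.linearIndependent hc (fun x => congrFun hu x) (j := i) (by simp [hi])
    exact (Finset.mem_filter.1 hi).2 this
  have hsum : ∀ x, ∑ l ∈ J.image lam, u l x = ∑ i, c i * E i x := by
    intro x
    rw [Finset.sum_fiberwise_of_maps_to (fun i hi => Finset.mem_image_of_mem lam hi)
      fun i => c i * E i x]
    refine Finset.sum_subset (Finset.subset_univ _) fun i _ hi => ?_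
    have : c i = 0 := by simpa [hJ] using hi
    rw [this, zero_mul]
  obtain ⟨l, hl, hzl⟩ := CyclicZeros.exists_of_sum hc hsol hne (hJne.image lam)
    (hz.congr fun x hx => by rw [hsum, hx])
  obtain ⟨i, hi, rfl⟩ := Finset.mem_image.1 hl
  exact hM i N ((hsol _ hl).cyclicZeros_of_same_eigenvalue hc (h.sol i) (hne _ hl) hzl)

/-- There is a combination whose zeros are exactly `T`, all of them simple. -/
lemma IsOrthogonalFamily.exists_simple_zeros (hc : IsCoeff r s)
    (h : IsOrthogonalFamily r s lam E W) {T : Finset ℝ}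
    (hM : ∀ i N, CyclicZeros (E i) N → N ≤ T.card) (hcard : T.card < Fintype.card ι)
    (hT : ∀ x ∈ T, x ∈ Set.Ico 0 (2 * Real.pi)) :
    ∃ c : ι → ℝ, (∀ x ∈ T, ∑ i, c i * E i x = 0) ∧
      (∀ x ∈ Set.Ico 0 (2 * Real.pi), ∑ i, c i * E i x = 0 → x ∈ T) ∧
      ∀ x ∈ T, ∑ i, c i * W i x ≠ 0 := by
  classical
  obtain ⟨c, hc0, hcT⟩ := exists_ne_zero_vanishing E T hcard
  have hperE : ∀ d : ι → ℝ, Function.Periodic (fun x => ∑ i, d i * E i x) (2 * Real.pi) :=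
    fun d x => Finset.sum_congr rfl fun i _ => by rw [(h.sol i).per_u]
  have hperW : Function.Periodic (fun x => ∑ i, c i * W i x) (2 * Real.pi) :=
    fun x => Finset.sum_congr rfl fun i _ => by rw [(h.sol i).per_w]
  have hderE : ∀ x, HasDerivAt (fun x => ∑ i, c i * E i x) (s x * ∑ i, c i * W i x) x := by
    intro x
    have := HasDerivAt.fun_sum (u := Finset.univ) fun i _ => ((h.sol i).deriv_u x).const_mul (c i)
    refine this.congr_deriv ?_
    rw [Finset.mul_sum]
    exact Finset.sum_congr rfl fun i _ => by ring
  have hderW : ∀ x, HasDerivAt (fun x => ∑ i, c i * W i x)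
      (-r x * ∑ i, (lam i * c i) * E i x) x := by
    intro x
    have := HasDerivAt.fun_sum (u := Finset.univ) fun i _ => ((h.sol i).deriv_w x).const_mul (c i)
    refine this.congr_deriv ?_
    rw [Finset.mul_sum]
    exact Finset.sum_congr rfl fun i _ => by ring
  refine ⟨c, hcT, fun x hx hx0 => ?_, fun a ha hwa => ?_⟩
  · by_contra hxT
    have hz := cyclicZeros_of_finset (hperE c) (insert x T)
      (fun y hy => (Finset.mem_insert.1 hy).elim (fun e => e ▸ hx) (hT y))
      (fun y hy => (Finset.mem_insert.1 hy).elim (fun e => e ▸ hx0) (hcT y))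
      (Finset.insert_nonempty _ _)
    have := h.cyclicZeros_le hc hM hc0 hz
    rw [Finset.card_insert_of_notMem hxT] at this
    omega
  -- At a double zero `a` the `W`-sum vanishes at `a` and once in each gap, hence `T.card + 1`
  -- times; one more Rolle step brings these zeros back to the span of the `E i`, against the bound.
  · obtain ⟨t, h0, h1, h2, h3⟩ := exists_sorted_zeros (hperE c) T hT hcT ha
    have hzW : CyclicZeros (fun x => ∑ i, c i * W i x) (T.card + 1) :=
      CyclicZeros.interlace_succ (Finset.card_pos.2 ⟨a, ha⟩) h1 h2 h3 hperW
        (fun _ _ => exists_zero_of_hasDerivAt_mul hderE fun x => (hc.pos_s x).ne')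
        (by rw [h0]; exact hwa)
    have hzE : CyclicZeros (fun x => ∑ i, (lam i * c i) * E i x) (T.card + 1) :=
      hzW.interlace (hperE _) fun _ _ => exists_zero_of_hasDerivAt_mul hderW
        fun x => (neg_neg_of_pos (hc.pos_r x)).ne
    -- If multiplication by the eigenvalues kills the coefficients, the combination is constant, and
    -- it vanishes at `a`.
    by_cases hlc : (fun i => lam i * c i) = 0
    · have hw0 : ∀ x, ∑ i, c i * W i x = 0 := fun x => Finset.sum_eq_zero fun i _ => by
        rcases mul_eq_zero.1 (congrFun hlc i) with h4 | h4
        · have := h.sol i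
          rw [h4] at this
          rw [this.w_eq_zero_of_eigenvalue_zero hc, mul_zero]
        · rw [h4, zero_mul]
      have hconst : ∀ x, ∑ i, c i * E i x = 0 := fun x => by
        rw [← hcT a ha]
        exact is_const_of_deriv_eq_zero (fun x => (hderE x).differentiableAt)
          (fun x => by rw [(hderE x).deriv, hw0, mul_zero]) x a
      exact hc0 (funext fun j => h.linearIndependent hc hconst (Finset.mem_univ j))
    · have := h.cyclicZeros_le hc hM hlc hzE
      omega

end Chebyshev

/-! ### Sign changes of continuous periodic functions -/

section Signs

/-- `f` does not change sign at `x`. -/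
def LocallyOneSigned (f : ℝ → ℝ) (x : ℝ) : Prop :=
  (∀ᶠ y in 𝓝 x, 0 ≤ f y) ∨ ∀ᶠ y in 𝓝 x, f y ≤ 0

/-- `f` changes sign at `x`. -/
def ChangesSign (f : ℝ → ℝ) (x : ℝ) : Prop := LocallyOneSigned (fun y => f y * (y - x)) x

variable {f g : ℝ → ℝ} {x : ℝ}

lemma locallyOneSigned_of_ne_zero (hf : ContinuousAt f x) (h : f x ≠ 0) :
    LocallyOneSigned f x := by
  rcases h.lt_or_gt with h | h
  · exact Or.inr ((hf.eventually_lt continuousAt_const h).mono fun _ h => h.le)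
  · exact Or.inl ((continuousAt_const.eventually_lt hf h).mono fun _ h => h.le)

lemma LocallyOneSigned.mul (hf : LocallyOneSigned f x) (hg : LocallyOneSigned g x) :
    LocallyOneSigned (fun y => f y * g y) x := by
  rcases hf with hf | hf <;> rcases hg with hg | hg
  · exact Or.inl (hf.and hg |>.mono fun _ h => mul_nonneg h.1 h.2)
  · exact Or.inr (hf.and hg |>.mono fun _ h => mul_nonpos_of_nonneg_of_nonpos h.1 h.2)
  · exact Or.inr (hf.and hg |>.mono fun _ h => mul_nonpos_of_nonpos_of_nonneg h.1 h.2)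
  · exact Or.inl (hf.and hg |>.mono fun _ h => mul_nonneg_of_nonpos_of_nonpos h.1 h.2)

lemma ChangesSign.mul_locallyOneSigned (hf : ChangesSign f x) (hg : LocallyOneSigned g x) :
    ChangesSign (fun y => f y * g y) x := by
  have := LocallyOneSigned.mul hf hg
  have e : (fun y => f y * g y * (y - x)) = fun y => f y * (y - x) * g y := by
    funext y; ring
  rwa [ChangesSign, e]

/-- The product carries the factor `(y - x) ^ 2`, which can be cancelled for `y ≠ x`; at `x` itself
`h0` is needed. -/
lemma ChangesSign.mul (hf : ChangesSign f x) (hg : ChangesSign g x) (h0 : g x = 0) :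
    LocallyOneSigned (fun y => f y * g y) x := by
  have e : ∀ y, f y * (y - x) * (g y * (y - x)) = f y * g y * (y - x) ^ 2 := fun y => by ring
  have h1 := LocallyOneSigned.mul hf hg
  simp only [LocallyOneSigned, e] at h1
  refine h1.imp (fun h => ?_) fun h => ?_ <;>
  · refine h.mono fun y hy => ?_
    rcases eq_or_ne y x with rfl | hyx
    · simp [h0]
    · have : 0 < (y - x) ^ 2 := by have := sub_ne_zero.2 hyx; positivity
      nlinarith

lemma changesSign_of_hasDerivAt {f' : ℝ} (hf : HasDerivAt f f' x) (h0 : f x = 0) (hf' : f' ≠ 0) :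
    ChangesSign f x := by
  have h1 := hf.tendsto_slope
  have e : ∀ y, f y * (y - x) = slope f x y * (y - x) ^ 2 := by
    intro y
    rcases eq_or_ne y x with rfl | hyx
    · simp
    · have := sub_ne_zero.2 hyx
      rw [slope_def_field, h0]
      field_simp
      ring
  simp only [ChangesSign, LocallyOneSigned, e]
  rcases hf'.lt_or_gt with h | h
  · right
    have := eventually_nhdsWithin_iff.1 (h1.eventually_lt_const h)
    refine this.mono fun y hy => ?_
    rcases eq_or_ne y x with rfl | hyx
    · simp
    · exact mul_nonpos_of_nonpos_of_nonneg (hy hyx).le (sq_nonneg _)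
  · left
    have := eventually_nhdsWithin_iff.1 (h1.eventually_const_lt h)
    refine this.mono fun y hy => ?_
    rcases eq_or_ne y x with rfl | hyx
    · simp
    · exact mul_nonneg (hy hyx).le (sq_nonneg _)

lemma one_signed_of_ne_zero (hf : Continuous f) {s : Set ℝ} (hs : s.OrdConnected)
    (h : ∀ y ∈ s, f y ≠ 0) : (∀ y ∈ s, 0 ≤ f y) ∨ ∀ y ∈ s, f y ≤ 0 := by
  by_contra! hcon
  obtain ⟨⟨a, ha, ha0⟩, b, hb, hb0⟩ := hcon
  obtain ⟨c, hc, hc0⟩ := hs.isPreconnected.intermediate_value ha hb hf.continuousOn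
    ⟨ha0.le, hb0.le⟩
  exact h c hc hc0

lemma locallyOneSigned_or_changesSign (hf : Continuous f) (h : ∀ᶠ y in 𝓝[≠] x, f y ≠ 0) :
    LocallyOneSigned f x ∨ ChangesSign f x := by
  by_cases h0 : f x = 0
  swap
  · exact Or.inl (locallyOneSigned_of_ne_zero hf.continuousAt h0)
  obtain ⟨δ, hδ, hball⟩ := Metric.eventually_nhds_iff_ball.1 (eventually_nhdsWithin_iff.1 h)
  rw [Real.ball_eq_Ioo] at hball
  have hnhds : Set.Ioo (x - δ) (x + δ) ∈ 𝓝 x := Ioo_mem_nhds (by linarith) (by linarith)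
  have hL := one_signed_of_ne_zero hf (s := Set.Ioo (x - δ) x) Set.ordConnected_Ioo fun y hy =>
    hball y ⟨hy.1, by linarith [hy.2]⟩ hy.2.ne
  have hR := one_signed_of_ne_zero hf (s := Set.Ioo x (x + δ)) Set.ordConnected_Ioo fun y hy =>
    hball y ⟨by linarith [hy.1], hy.2⟩ hy.1.ne'
  have key : ∀ P : ℝ → Prop, (∀ y ∈ Set.Ioo (x - δ) x, P y) → P x →
      (∀ y ∈ Set.Ioo x (x + δ), P y) → ∀ᶠ y in 𝓝 x, P y := by
    intro P h1 h2 h3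
    filter_upwards [hnhds] with y hy
    rcases lt_trichotomy y x with h4 | h4 | h4
    · exact h1 y ⟨hy.1, h4⟩
    · rw [h4]; exact h2
    · exact h3 y ⟨h4, hy.2⟩
  rcases hL with hL | hL <;> rcases hR with hR | hR
  · exact Or.inl (Or.inl (key _ hL h0.ge hR))
  · refine Or.inr (Or.inr (key _ (fun y hy => ?_) (by simp) fun y hy => ?_))
    · exact mul_nonpos_of_nonneg_of_nonpos (hL y hy) (by linarith [hy.2])
    · exact mul_nonpos_of_nonpos_of_nonneg (hR y hy) (by linarith [hy.1])
  · refine Or.inr (Or.inl (key _ (fun y hy => ?_) (by simp) fun y hy => ?_))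
    · exact mul_nonneg_of_nonpos_of_nonpos (hL y hy) (by linarith [hy.2])
    · exact mul_nonneg (hR y hy) (by linarith [hy.1])
  · exact Or.inl (Or.inr (key _ hL h0.le hR))

/-- The two sign conditions define open sets covering the line, disjoint because `f` vanishes on no
neighbourhood; connectedness leaves only one. -/
lemma one_signed_of_locallyOneSigned (h : ∀ x, LocallyOneSigned f x)
    (hne : ∀ x, ∃ᶠ y in 𝓝 x, f y ≠ 0) : (∀ x, 0 ≤ f x) ∨ ∀ x, f x ≤ 0 := by
  have hU : IsOpen {x | ∀ᶠ y in 𝓝 x, 0 ≤ f y} := isOpen_setOfPred_eventually_nhds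
  have hV : IsOpen {x | ∀ᶠ y in 𝓝 x, f y ≤ 0} := isOpen_setOfPred_eventually_nhds
  have hpre := (isPreconnected_univ (α := ℝ)).subset_or_subset hU hV
    (Set.disjoint_left.2 fun x h1 h2 => hne x <|
      (Filter.Eventually.and h1 h2).mono fun y hy => not_not.2 (le_antisymm hy.2 hy.1))
    fun x _ => h x
  exact hpre.imp (fun h x => (h (Set.mem_univ x)).self_of_nhds)
    fun h x => (h (Set.mem_univ x)).self_of_nhds

/-- If `g` changes sign exactly where `f` does and has no other zeros, then `f g` has one sign. -/
lemma one_signed_mul (hf : Continuous f) (hg : Continuous g)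
    (hf0 : ∀ x, ∀ᶠ y in 𝓝[≠] x, f y ≠ 0) (hg0 : ∀ x, ∀ᶠ y in 𝓝[≠] x, g y ≠ 0)
    (h1 : ∀ x, g x = 0 → ¬ LocallyOneSigned f x ∧ ChangesSign g x)
    (h2 : ∀ x, g x ≠ 0 → LocallyOneSigned f x) :
    (∀ x, 0 ≤ f x * g x) ∨ ∀ x, f x * g x ≤ 0 := by
  refine one_signed_of_locallyOneSigned (fun x => ?_) fun x => ?_
  · by_cases hx : g x = 0
    · exact ((locallyOneSigned_or_changesSign hf (hf0 x)).resolve_left (h1 x hx).1).mul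
        (h1 x hx).2 hx
    · exact (h2 x hx).mul (locallyOneSigned_of_ne_zero hg.continuousAt hx)
  · have : ∀ᶠ y in 𝓝[≠] x, f y * g y ≠ 0 := ((hf0 x).and (hg0 x)).mono fun y h =>
      mul_ne_zero h.1 h.2
    exact this.frequently.filter_mono nhdsWithin_le_nhds

lemma LocallyOneSigned.add_period {c : ℝ} (hf : Function.Periodic f c)
    (h : LocallyOneSigned f x) : LocallyOneSigned f (x + c) := by
  have ht : Tendsto (fun y => y - c) (𝓝 (x + c)) (𝓝 x) := by
    have : Tendsto (fun y => y - c) (𝓝 (x + c)) (𝓝 (x + c - c)) :=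
      (continuous_id.sub continuous_const).tendsto _
    simpa using this
  refine h.imp (fun h => ?_) fun h => ?_ <;>
  exact (ht.eventually h).mono fun y hy => by rwa [hf.sub_eq] at hy

lemma locallyOneSigned_add_zsmul {c : ℝ} (hf : Function.Periodic f c) (n : ℤ) :
    LocallyOneSigned f (x + n • c) ↔ LocallyOneSigned f x :=
  ⟨fun h => by simpa using h.add_period (hf.zsmul (-n)), fun h => h.add_period (hf.zsmul n)⟩

lemma exists_eq_add_zsmul (x : ℝ) :
    ∃ t ∈ Set.Ico 0 (2 * Real.pi), ∃ n : ℤ, x = t + n • (2 * Real.pi) :=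
  ⟨toIcoMod Real.two_pi_pos 0 x, by simpa using toIcoMod_mem_Ico Real.two_pi_pos 0 x,
    toIcoDiv Real.two_pi_pos 0 x, (toIcoMod_add_toIcoDiv_zsmul _ _ _).symm⟩

lemma eventually_ne_zero_of_finite (hf : Function.Periodic f (2 * Real.pi))
    (hfin : {θ ∈ Set.Ico 0 (2 * Real.pi) | f θ = 0}.Finite) (x : ℝ) :
    ∀ᶠ y in 𝓝[≠] x, f y ≠ 0 := by
  have hpi := Real.two_pi_pos
  -- A period centred at `x` has `x` in its interior, and reduction modulo `2π` injects its zeros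
  -- into the given finite set.
  set a := x - Real.pi
  have hF : {θ ∈ Set.Ico a (a + 2 * Real.pi) | f θ = 0}.Finite := by
    refine Set.Finite.of_injOn (f := toIcoMod hpi 0) ?_ ?_ hfin
    · intro y hy
      refine ⟨by simpa using toIcoMod_mem_Ico hpi 0 y, ?_⟩
      rw [toIcoMod, hf.sub_zsmul_eq]
      exact hy.2
    · intro y hy z hz hyz
      rw [← (toIcoMod_eq_self hpi).2 hy.1, ← (toIcoMod_eq_self hpi).2 hz.1,
        ← toIcoMod_toIcoMod hpi a 0 y, hyz, toIcoMod_toIcoMod]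
  have h1 : ({θ ∈ Set.Ico a (a + 2 * Real.pi) | f θ = 0} \ {x})ᶜ ∈ 𝓝 x :=
    (hF.sdiff).isClosed.isOpen_compl.mem_nhds fun h => h.2 rfl
  have h2 : Set.Ico a (a + 2 * Real.pi) ∈ 𝓝 x :=
    Ico_mem_nhds (by linarith [Real.pi_pos]) (by linarith [Real.pi_pos])
  filter_upwards [nhdsWithin_le_nhds h1, nhdsWithin_le_nhds h2, self_mem_nhdsWithin]
    with y hy1 hy2 hy3 hy0
  exact hy1 ⟨⟨hy2, hy0⟩, hy3⟩

/-- The number of sign changes in a period is even. -/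
lemma even_card_sign_changes (hf : Continuous f) (hper : Function.Periodic f (2 * Real.pi))
    (hf0 : ∀ x, ∀ᶠ y in 𝓝[≠] x, f y ≠ 0) {T : Finset ℝ}
    (hT : ∀ x, x ∈ T ↔ x ∈ Set.Ico 0 (2 * Real.pi) ∧ ¬ LocallyOneSigned f x) : Even T.card := by
  classical
  have hd : ∀ t x, HasDerivAt (fun y => Real.sin ((y - t) / 2)) (Real.cos ((x - t) / 2) / 2) x :=
    fun t x => by
      have := (((hasDerivAt_id x).sub_const t).div_const 2).sin
      exact this.congr_deriv (by simp; ring)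
  have hcos : ∀ {a}, Real.sin a = 0 → Real.cos a ≠ 0 := fun {a} hs hcos => by
    have := Real.sin_sq_add_cos_sq a
    simp [hs, hcos] at this
  have hd' : ∀ t x, Real.sin ((x - t) / 2) = 0 → Real.cos ((x - t) / 2) / 2 ≠ 0 := fun t x h =>
    div_ne_zero (hcos h) two_ne_zero
  -- A model function with simple zeros exactly at the translates of `T`. For odd `T.card` it
  -- changes sign under `2π`, which is incompatible with `f g` having one sign.
  set g : ℝ → ℝ := fun y => ∏ t ∈ T, Real.sin ((y - t) / 2) with hg
  have hgc : Continuous g := by fun_prop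
  have hg0 : ∀ x, ∀ᶠ y in 𝓝[≠] x, g y ≠ 0 := by
    intro x
    have : ∀ᶠ y in 𝓝[≠] x, ∀ t ∈ T, Real.sin ((y - t) / 2) ≠ 0 := by
      refine (Filter.eventually_all_finset T).2 fun t _ => ?_
      by_cases h : Real.sin ((x - t) / 2) = 0
      · exact (hd t x).eventually_ne (hd' t x h)
      · exact nhdsWithin_le_nhds ((hd t x).continuousAt.eventually_ne h)
    exact this.mono fun y hy => Finset.prod_ne_zero_iff.2 hy
  have hsign := one_signed_mul hf hgc hf0 hg0 (fun x hx => ?_) fun x hx => ?_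
  · by_contra hodd
    rw [Nat.not_even_iff_odd] at hodd
    have hanti : ∀ x, f (x + 2 * Real.pi) * g (x + 2 * Real.pi) = -(f x * g x) := by
      intro x
      have : g (x + 2 * Real.pi) = -g x := by
        have e : ∀ t, Real.sin ((x + 2 * Real.pi - t) / 2) = -1 * Real.sin ((x - t) / 2) :=
          fun t => by
            rw [show (x + 2 * Real.pi - t) / 2 = (x - t) / 2 + Real.pi by ring, Real.sin_add_pi]
            ring
        simp only [hg, e, Finset.prod_mul_distrib, Finset.prod_const, hodd.neg_one_pow]
        ring
      rw [hper, this, mul_neg]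
    have hzero : ∀ x, f x * g x = 0 := by
      intro x
      rcases hsign with h | h <;> linarith [h x, h (x + 2 * Real.pi), hanti x]
    obtain ⟨y, hy⟩ := ((hf0 0).and (hg0 0)).exists
    exact mul_ne_zero hy.1 hy.2 (hzero y)
  · obtain ⟨t, ht, ht0⟩ := Finset.prod_eq_zero_iff.1 hx
    constructor
    · obtain ⟨n, hn⟩ := Real.sin_eq_zero_iff.1 ht0
      have : x = t + n • (2 * Real.pi) := by
        rw [zsmul_eq_mul]; linarith
      rw [this, locallyOneSigned_add_zsmul hper]
      exact ((hT t).1 ht).2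
    · have h1 : g = fun y => Real.sin ((y - t) / 2) * ∏ t ∈ T.erase t, Real.sin ((y - t) / 2) := by
        funext y
        exact (Finset.mul_prod_erase T _ ht).symm
      rw [h1]
      refine (changesSign_of_hasDerivAt (hd t x) ht0 (hd' t x ht0)).mul_locallyOneSigned
        (locallyOneSigned_of_ne_zero (by fun_prop) (Finset.prod_ne_zero_iff.2 fun t' ht' h' => ?_))
      obtain ⟨n, hn⟩ := Real.sin_eq_zero_iff.1 ht0
      obtain ⟨m, hm⟩ := Real.sin_eq_zero_iff.1 h'
      have hpi := Real.pi_pos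
      have htI := ((hT t).1 ht).1
      have htI' := ((hT t').1 (Finset.mem_of_mem_erase ht')).1
      have h2 : t' - t = 2 * Real.pi * ((n - m : ℤ) : ℝ) := by push_cast; linarith
      have h3 : n - m = 0 := by
        have h4 : ((n - m : ℤ) : ℝ) < 1 := by nlinarith [htI.1, htI'.2]
        have h5 : (-1 : ℝ) < ((n - m : ℤ) : ℝ) := by nlinarith [htI.2, htI'.1]
        have h4' : n - m < 1 := by exact_mod_cast h4
        have h5' : -1 < n - m := by exact_mod_cast h5
        omega
      rw [h3, Int.cast_zero, mul_zero] at h2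
      exact Finset.ne_of_mem_erase ht' (by linarith)
  · by_contra hno
    obtain ⟨t, ht, n, rfl⟩ := exists_eq_add_zsmul x
    rw [locallyOneSigned_add_zsmul hper] at hno
    refine hx (Finset.prod_eq_zero ((hT t).2 ⟨ht, hno⟩) ?_)
    rw [Real.sin_eq_zero_iff]
    exact ⟨n, by rw [zsmul_eq_mul]; ring⟩

/-- A periodic function with simple zeros exactly at the sign changes of `f` is not orthogonal
to `f`. -/
lemma integral_ne_zero_of_sign_changes {r g' : ℝ → ℝ} (hf : Continuous f)
    (hper : Function.Periodic f (2 * Real.pi))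
    (hf0 : ∀ x, ∀ᶠ y in 𝓝[≠] x, f y ≠ 0) {T : Finset ℝ}
    (hT : ∀ x, x ∈ T ↔ x ∈ Set.Ico 0 (2 * Real.pi) ∧ ¬ LocallyOneSigned f x)
    (hr : Continuous r) (hrpos : ∀ x, 0 < r x) (hrper : Function.Periodic r (2 * Real.pi))
    (hg : ∀ x, HasDerivAt g (g' x) x) (hgper : Function.Periodic g (2 * Real.pi))
    (hgper' : Function.Periodic g' (2 * Real.pi))
    (hgT : ∀ x ∈ Set.Ico 0 (2 * Real.pi), g x = 0 ↔ x ∈ T) (hgT' : ∀ x ∈ T, g' x ≠ 0) :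
    ∫ x in (0 : ℝ)..(2 * Real.pi), f x * g x * r x ≠ 0 := by
  have hgc : Continuous g := continuous_iff_continuousAt.2 fun x => (hg x).continuousAt
  have hg0 : ∀ x, ∀ᶠ y in 𝓝[≠] x, g y ≠ 0 := eventually_ne_zero_of_finite hgper
    (T.finite_toSet.subset fun x hx => (hgT x hx.1).1 hx.2)
  have hsign := one_signed_mul hf hgc hf0 hg0 (fun x hx => ?_) fun x hx => ?_
  · intro hint
    have hcont : Continuous fun x => f x * g x * r x := (hf.mul hgc).mul hr
    have hperiod : Function.Periodic (fun x => f x * g x * r x) (2 * Real.pi) := fun x => by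
      simp only [hper x, hgper x, hrper x]
    have hzero : ∀ x, f x * g x * r x = 0 := by
      rcases hsign with h | h
      · exact eq_zero_of_integral_eq_zero hcont hperiod
          (fun x => mul_nonneg (h x) (hrpos x).le) hint
      · intro x
        have := eq_zero_of_integral_eq_zero (f := fun x => -(f x * g x * r x)) hcont.neg
          (fun x => congrArg Neg.neg (hperiod x))
          (fun x => neg_nonneg.2 (mul_nonpos_of_nonpos_of_nonneg (h x) (hrpos x).le))
          (by rw [intervalIntegral.integral_neg, hint, neg_zero]) x
        simpa using this
    obtain ⟨y, hy⟩ := ((hf0 0).and (hg0 0)).exists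
    exact mul_ne_zero (mul_ne_zero hy.1 hy.2) (hrpos y).ne' (hzero y)
  · obtain ⟨t, ht, n, rfl⟩ := exists_eq_add_zsmul x
    have hx' := hx
    rw [hgper.zsmul n] at hx'
    have htT := (hgT t ht).1 hx'
    rw [locallyOneSigned_add_zsmul hper]
    refine ⟨((hT t).1 htT).2, changesSign_of_hasDerivAt (hg _) hx ?_⟩
    rw [hgper'.zsmul n]
    exact hgT' t htT
  · by_contra hno
    obtain ⟨t, ht, n, rfl⟩ := exists_eq_add_zsmul x
    rw [locallyOneSigned_add_zsmul hper] at hno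
    rw [hgper.zsmul n] at hx
    exact hx ((hgT t ht).2 ((hT t).2 ⟨ht, hno⟩))

end Signs
-- Coefficients given by the unit circle
lemma periodic_deriv {F : Type*} [NormedAddCommGroup F] [NormedSpace ℝ F] {f : ℝ → F} {c : ℝ}
    (hf : Function.Periodic f c) : Function.Periodic (deriv f) c := fun x => by
  rw [← deriv_comp_add_const, show (fun x => f (x + c)) = f from funext hf]

lemma hasDerivAt_fst {f : ℝ → ℝ × ℝ} {f' : ℝ × ℝ} {x : ℝ} (h : HasDerivAt f f' x) :
    HasDerivAt (fun t => (f t).1) f'.1 x := by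
  simpa using h.hasFDerivAt.fst.hasDerivAt

lemma hasDerivAt_snd {f : ℝ → ℝ × ℝ} {f' : ℝ × ℝ} {x : ℝ} (h : HasDerivAt f f' x) :
    HasDerivAt (fun t => (f t).2) f'.2 x := by
  simpa using h.hasFDerivAt.snd.hasDerivAt

namespace IsUnitCircle

variable {N : Seminorm ℝ (ℝ × ℝ)} {p : ℝ → ℝ × ℝ}

lemma hasDerivAt_p (hp : IsUnitCircle N p) (x : ℝ) : HasDerivAt p (deriv p x) x :=
  (hp.smooth.differentiable (by simp)).differentiableAt.hasDerivAt

lemma contDiff_deriv (hp : IsUnitCircle N p) : ContDiff ℝ ∞ (deriv p) :=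
  (contDiff_infty_iff_deriv.1 hp.smooth).2

lemma hasDerivAt_deriv (hp : IsUnitCircle N p) (x : ℝ) :
    HasDerivAt (deriv p) (deriv (deriv p) x) x :=
  (hp.contDiff_deriv.differentiable (by simp)).differentiableAt.hasDerivAt

lemma periodic (hp : IsUnitCircle N p) : Function.Periodic p (2 * Real.pi) := fun x => by
  rw [two_mul, ← add_assoc, hp.antipodal, hp.antipodal, neg_neg]

/-- The determinant of `p t` with the tangent direction at `x` decreases strictly on `[x, x + π]`,
and antipodality turns it into its negative there; so it is positive at `x`. -/
lemma weight_pos (hp : IsUnitCircle N p) (x : ℝ) : 0 < weight p x := by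
  obtain ⟨c, hc⟩ := hp.tangent
  choose ρ hρ hd using hc
  have hder : ∀ t, HasDerivAt
      (fun t => (p t).1 * Real.sin (x + c) - (p t).2 * Real.cos (x + c))
      (ρ t * Real.sin (x - t)) t := by
    intro t
    have h := hp.hasDerivAt_p t
    refine (((hasDerivAt_fst h).mul_const _).sub ((hasDerivAt_snd h).mul_const _)).congr_deriv ?_
    rw [hd t, show x - t = (x + c) - (t + c) by ring, Real.sin_sub]
    ring
  have hpi := Real.pi_pos
  obtain ⟨t, ht, hslope⟩ := exists_hasDerivAt_eq_slope _ _ (by linarith : x < x + Real.pi)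
    (fun t _ => (hder t).continuousAt.continuousWithinAt) fun t _ => hder t
  have hneg : ρ t * Real.sin (x - t) < 0 :=
    mul_neg_of_pos_of_neg (hρ t) (Real.sin_neg_of_neg_of_neg_pi_lt (by linarith [ht.1])
      (by linarith [ht.2]))
  rw [hslope, hp.antipodal, add_sub_cancel_left, div_lt_iff₀ hpi, zero_mul] at hneg
  simp only [Prod.fst_neg, Prod.snd_neg] at hneg
  have : weight p x = ρ x * ((p x).1 * Real.sin (x + c) - (p x).2 * Real.cos (x + c)) := by
    rw [weight, det, hd x]; ring
  rw [this]
  exact mul_pos (hρ x) (by linarith)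

/-- With `p' = ρ (cos, sin)` the value is `ρ ^ 2`. Differentiating the vanishing normal component of
`p'` gives this without differentiability of `ρ`. -/
lemma det_deriv_pos (hp : IsUnitCircle N p) (x : ℝ) : 0 < det (deriv p x) (deriv (deriv p) x) := by
  obtain ⟨c, hc⟩ := hp.tangent
  choose ρ hρ hd using hc
  have h0 : (fun t => (deriv p t).2 * Real.cos (t + c) - (deriv p t).1 * Real.sin (t + c))
      = fun _ => 0 := by
    funext t; rw [hd t]; ring
  have h := hp.hasDerivAt_deriv x
  have hcos := ((hasDerivAt_id x).add_const c).cos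
  have hsin := ((hasDerivAt_id x).add_const c).sin
  have h1 := ((hasDerivAt_snd h).mul hcos).sub ((hasDerivAt_fst h).mul hsin)
  have h2 : HasDerivAt
      (fun t => (deriv p t).2 * Real.cos (t + c) - (deriv p t).1 * Real.sin (t + c)) _ x := h1
  rw [h0] at h2
  have h3 := h2.unique (hasDerivAt_const x 0)
  simp only [id, mul_one] at h3
  rw [hd x] at h3
  have h4 : det (deriv p x) (deriv (deriv p) x) = ρ x ^ 2 := by
    rw [det, hd x]
    have := Real.sin_sq_add_cos_sq (x + c)
    linear_combination ρ x * h3 + ρ x ^ 2 * this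
  rw [h4]
  exact pow_pos (hρ x) 2

lemma continuous_weight (hp : IsUnitCircle N p) : Continuous (weight p) := by
  have h1 := hp.smooth.continuous
  have h2 := hp.contDiff_deriv.continuous
  unfold weight det
  fun_prop

/-- The derivative of the scalar factor contributes only a multiple of `p'`, which drops out of the
determinant. -/
lemma weight_dual (hp : IsUnitCircle N p) (x : ℝ) :
    weight (dual p) x = (weight p x)⁻¹ ^ 2 * det (deriv p x) (deriv (deriv p) x) := by
  have hr : DifferentiableAt ℝ (weight p) x := by
    have h := hp.hasDerivAt_p x
    have h' := hp.hasDerivAt_deriv x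
    exact (((hasDerivAt_fst h).mul (hasDerivAt_snd h')).sub
      ((hasDerivAt_snd h).mul (hasDerivAt_fst h'))).differentiableAt
  have hd : HasDerivAt (dual p) _ x :=
    (hr.inv (hp.weight_pos x).ne').hasDerivAt.smul (hp.hasDerivAt_deriv x)
  rw [weight, hd.deriv, dual]
  simp only [det, Prod.fst_add, Prod.snd_add, Prod.smul_fst, Prod.smul_snd, smul_eq_mul,
    Pi.inv_apply]
  ring

lemma isCoeff (hp : IsUnitCircle N p) : IsCoeff (weight p) (weight (dual p)) where
  cont_r := hp.continuous_weight
  cont_s := by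
    rw [funext hp.weight_dual]
    have h1 := hp.contDiff_deriv.continuous
    have h2 : Continuous (deriv (deriv p)) :=
      (contDiff_infty_iff_deriv.1 hp.contDiff_deriv).2.continuous
    refine ((hp.continuous_weight.inv₀ fun x => (hp.weight_pos x).ne').pow 2).mul ?_
    unfold det
    fun_prop
  pos_r := hp.weight_pos
  pos_s x := by
    rw [hp.weight_dual]
    exact mul_pos (pow_pos (inv_pos.2 (hp.weight_pos x)) 2) (hp.det_deriv_pos x)
  per_r x := by rw [weight, weight, hp.periodic x, periodic_deriv hp.periodic x]
  per_s x := by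
    rw [hp.weight_dual, hp.weight_dual, weight, weight, hp.periodic x, periodic_deriv hp.periodic x,
      periodic_deriv (periodic_deriv hp.periodic) x]

end IsUnitCircle

/-! ### Eigenfunctions, index and extremal eigenvalues -/

section Eigenfunctions

variable {N : Seminorm ℝ (ℝ × ℝ)} {p : ℝ → ℝ × ℝ} {lam : ℝ} {u v : ℝ → ℝ}

lemma IsEigenfunction.isPeriodicSolution (hp : IsUnitCircle N p) (h : IsEigenfunction p lam u) :
    IsPeriodicSolution (weight p) (weight (dual p)) lam u (quasiDeriv p u) where
  deriv_u x := by
    rw [quasiDeriv, mul_div_cancel₀ _ (hp.isCoeff.pos_s x).ne']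
    exact (h.isSolution.differentiable x).hasDerivAt
  deriv_w x := by
    refine (h.isSolution.differentiable_quasiDeriv x).hasDerivAt.congr_deriv ?_
    have h1 := h.isSolution.eqn x
    have h2 := (hp.weight_pos x).ne'
    field_simp at h1
    linarith
  per_u := h.periodic
  per_w x := by
    rw [quasiDeriv, quasiDeriv, periodic_deriv h.periodic x, hp.isCoeff.per_s x]

lemma IsEigenfunction.integral_of_index (hp : IsUnitCircle N p) (h : IsEigenfunction p lam u)
    {k : ℕ} (hk : index p u = k) :
    ∫ x in (0 : ℝ)..(2 * Real.pi),
      (quasiDeriv p u x * (weight (dual p) x * quasiDeriv p u x)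
        - u x * (-lam * weight p x * u x)) / (u x ^ 2 + quasiDeriv p u x ^ 2)
      = 2 * Real.pi * k := by
  have hs := h.isPeriodicSolution hp
  rw [index] at hk
  simp only [(hs.deriv_u _).deriv, (hs.deriv_w _).deriv] at hk
  have hpi := Real.two_pi_pos.ne'
  rw [← hk, ← mul_assoc, mul_one_div_cancel hpi, one_mul]

lemma IsEigenfunction.eigenvalue_pos (hp : IsUnitCircle N p) (h : IsEigenfunction p lam u)
    {k : ℕ} (hk1 : 1 ≤ k) (hk : index p u = k) : 0 < lam := by
  have hs := h.isPeriodicSolution hp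
  refine (hs.eigenvalue_nonneg hp.isCoeff h.ne_zero).lt_of_ne ?_
  rintro rfl
  have h1 := h.integral_of_index hp hk
  simp [hs.w_eq_zero_of_eigenvalue_zero hp.isCoeff, Real.pi_ne_zero] at h1
  omega

/-- The eigenvalue of an eigenfunction of index `k` determines the number of zeros. -/
lemma IsEigenfunction.cyclicZeros_le (hp : IsUnitCircle N p) {k : ℕ} (hk1 : 1 ≤ k)
    (hlam : lam ∈ eigenvaluesOfIndex p k) (hv : IsEigenfunction p lam v) {n : ℕ}
    (hz : CyclicZeros v n) : n ≤ 2 * k := by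
  obtain ⟨u, hu, hk⟩ := hlam
  exact (hu.isPeriodicSolution hp).cyclicZeros_le hp.isCoeff hu.ne_zero
    (hu.eigenvalue_pos hp hk1 hk) (hu.integral_of_index hp hk)
    ((hv.isPeriodicSolution hp).cyclicZeros_of_same_eigenvalue hp.isCoeff
      (hu.isPeriodicSolution hp) hv.ne_zero hz)

lemma IsEigenfunction.cyclicZeros_two_mul (hp : IsUnitCircle N p) {k : ℕ} (hk1 : 1 ≤ k)
    (hlam : lam ∈ eigenvaluesOfIndex p k) (hv : IsEigenfunction p lam v) :
    CyclicZeros v (2 * k) := by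
  obtain ⟨u, hu, hk⟩ := hlam
  exact (hu.isPeriodicSolution hp).cyclicZeros_of_same_eigenvalue hp.isCoeff
    (hv.isPeriodicSolution hp) hu.ne_zero
    ((hu.isPeriodicSolution hp).cyclicZeros_two_mul hp.isCoeff hu.ne_zero
      (hu.eigenvalue_pos hp hk1 hk) hk1 (hu.integral_of_index hp hk))

/-- The index of an eigenvalue is unique. -/
lemma index_unique (hp : IsUnitCircle N p) {k l : ℕ} (hk1 : 1 ≤ k) (hl1 : 1 ≤ l)
    (hk : lam ∈ eigenvaluesOfIndex p k) (hl : lam ∈ eigenvaluesOfIndex p l) : k = l := by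
  obtain ⟨v, hv, -⟩ := id hk
  have h1 := hv.cyclicZeros_le hp hl1 hl (hv.cyclicZeros_two_mul hp hk1 hk)
  have h2 := hv.cyclicZeros_le hp hk1 hk (hv.cyclicZeros_two_mul hp hl1 hl)
  omega

/-- Among `2k + 2` such eigenvalues some combination of eigenfunctions vanishes at `2k + 1`
prescribed points, and Sturm's bound passes these zeros to one eigenfunction, which has at most
`2k`. Finiteness ensures that the infimum and supremum in `eigenvalue` are attained. -/
lemma finite_eigenvaluesOfIndex (hp : IsUnitCircle N p) {k : ℕ} (hk1 : 1 ≤ k) :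
    (eigenvaluesOfIndex p k).Finite := by
  classical
  by_contra hinf
  obtain ⟨S, hS, hcard⟩ := Set.Infinite.exists_subset_card_eq hinf (2 * k + 2)
  have hex : ∀ l, ∃ u, l ∈ S → IsEigenfunction p l u := by
    intro l
    by_cases hl : l ∈ S
    · obtain ⟨u, hu, -⟩ := hS hl
      exact ⟨u, fun _ => hu⟩
    · exact ⟨0, fun h => absurd h hl⟩
  choose u hu using hex
  obtain ⟨T, hT, hTcard⟩ := (Set.Ico_infinite Real.two_pi_pos).exists_subset_card_eq (2 * k + 1)
  obtain ⟨c, hc0, hcT⟩ := exists_ne_zero_vanishing (fun l : S => u l) T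
    (by rw [Fintype.card_coe, hcard, hTcard]; omega)
  set d : ℝ → ℝ := fun l => if h : l ∈ S then c ⟨l, h⟩ else 0 with hd
  set J := S.filter fun l => d l ≠ 0 with hJ
  have hsum : ∀ x, ∑ l ∈ J, d l * u l x = ∑ l : S, c l * u l x := by
    intro x
    rw [Finset.sum_filter_of_ne (fun l _ h => left_ne_zero_of_mul h), ← Finset.sum_attach,
      Finset.univ_eq_attach]
    exact Finset.sum_congr rfl fun l _ => by simp [hd]
  have hJS : ∀ l ∈ J, l ∈ S := fun l hl => (Finset.mem_filter.1 hl).1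
  have hsol : ∀ l ∈ J, IsPeriodicSolution (weight p) (weight (dual p)) l (fun x => d l * u l x)
      (fun x => d l * quasiDeriv p (u l) x) := fun l hl => by
    simpa using IsPeriodicSolution.sum {l} d
      (U := u) (W := fun l => quasiDeriv p (u l)) (lam := l)
      (fun i hi => by
        rw [Finset.mem_singleton.1 hi]
        exact (hu l (hJS l hl)).isPeriodicSolution hp)
  have hJne : J.Nonempty := by
    obtain ⟨l, hl⟩ := Function.ne_iff.1 hc0
    exact ⟨l, by simpa [hJ, hd] using hl⟩
  have hz := cyclicZeros_of_finset (f := fun x => ∑ l ∈ J, d l * u l x)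
    (fun x => Finset.sum_congr rfl fun l hl => by rw [(hu l (hJS l hl)).periodic x]) T
    (fun x hx => hT hx) (fun x hx => by rw [hsum]; exact hcT x hx)
    (Finset.card_pos.1 (by omega))
  have hne : ∀ l ∈ J, (fun x => d l * u l x) ≠ 0 := fun l hl h0 =>
    (hu l (hJS l hl)).ne_zero (funext fun x =>
      (mul_eq_zero.1 (congrFun h0 x)).resolve_left (Finset.mem_filter.1 hl).2)
  obtain ⟨l, hl, hzl⟩ := CyclicZeros.exists_of_sum hp.isCoeff hsol hne hJne hz
  have := (hu l (hJS l hl)).cyclicZeros_le hp hk1 (hS (hJS l hl)) (hzl.congr fun x hx =>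
    (mul_eq_zero.1 hx).resolve_left (Finset.mem_filter.1 hl).2)
  omega

lemma IsEigenbasis.eigenvalue_mem (hp : IsUnitCircle N p) {e : ℕ → Fin 2 → ℝ → ℝ}
    (he : IsEigenbasis p e) {k : ℕ} (hk1 : 1 ≤ k) (i : Fin 2) :
    eigenvalue p k i ∈ eigenvaluesOfIndex p k := by
  rcases (eigenvaluesOfIndex p k).eq_empty_or_nonempty with hempty | hne
  · exfalso
    -- On the empty set `sInf` and `sSup` both default to `0`; then both `e k j` would be constant,
    -- and two constants cannot be orthonormal.
    have h0 : ∀ j, eigenvalue p k j = 0 := fun j => by simp [eigenvalue, hempty]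
    have hconst : ∀ j, ∃ a, ∀ x, e k j x = a := by
      intro j
      have hs := (he.isEigenfunction k hk1 j).isPeriodicSolution hp
      rw [h0] at hs
      exact ⟨e k j 0, fun x => is_const_of_deriv_eq_zero
        (fun x => (hs.deriv_u x).differentiableAt) (fun x => by
          rw [(hs.deriv_u x).deriv, hs.w_eq_zero_of_eigenvalue_zero hp.isCoeff, mul_zero]) x 0⟩
    choose a ha using hconst
    have ho := he.orthonormal k hk1
    simp only [innerProd, ha, intervalIntegral.integral_const_mul] at ho
    have h00 := ho 0 0
    have h11 := ho 1 1
    have h01 := ho 0 1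
    simp only [if_true, zero_ne_one, if_false] at h00 h11 h01
    have : a 0 ≠ 0 ∧ a 1 ≠ 0 := by
      constructor <;> intro h <;> simp [h] at h00 h11
    have hI : (∫ x in (0 : ℝ)..(2 * Real.pi), weight p x) = 0 :=
      (mul_eq_zero.1 h01).resolve_left (mul_ne_zero this.1 this.2)
    rw [hI, mul_zero] at h00
    exact zero_ne_one h00
  · have hfin := finite_eigenvaluesOfIndex hp hk1
    rw [eigenvalue]
    split_ifs
    · exact hne.csInf_mem hfin
    · exact hne.csSup_mem hfin

end Eigenfunctions

/-! ### Orthogonality and norm convergence -/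

section Expansion

variable {N : Seminorm ℝ (ℝ × ℝ)} {p : ℝ → ℝ × ℝ} {f g : ℝ → ℝ}

lemma innerProd_sq_le (hp : IsUnitCircle N p) (hf : Continuous f) (hg : Continuous g) :
    innerProd p f g ^ 2 ≤ innerProd p f f * innerProd p g g := by
  have hr := hp.continuous_weight
  have key : ∀ x : ℝ, 0 ≤ innerProd p g g * (x * x) + 2 * innerProd p f g * x + innerProd p f f := by
    intro x
    have h1 : 0 ≤ ∫ θ in (0 : ℝ)..(2 * Real.pi), (f θ + x * g θ) ^ 2 * weight p θ :=
      intervalIntegral.integral_nonneg Real.two_pi_pos.le fun θ _ =>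
        mul_nonneg (sq_nonneg _) (hp.weight_pos θ).le
    have e : ∀ θ, (f θ + x * g θ) ^ 2 * weight p θ = (x * x) * (g θ * g θ * weight p θ)
        + 2 * x * (f θ * g θ * weight p θ) + f θ * f θ * weight p θ := fun θ => by ring
    simp only [e] at h1
    have i1 : Continuous fun θ => (x * x) * (g θ * g θ * weight p θ) := by fun_prop
    have i12 : Continuous fun θ => (x * x) * (g θ * g θ * weight p θ)
        + 2 * x * (f θ * g θ * weight p θ) := by fun_prop
    have i2 : Continuous fun θ => 2 * x * (f θ * g θ * weight p θ) := by fun_prop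
    have i3 : Continuous fun θ => f θ * f θ * weight p θ := by fun_prop
    rw [intervalIntegral.integral_add (i12.intervalIntegrable _ _)
      (i3.intervalIntegrable _ _), intervalIntegral.integral_add (i1.intervalIntegrable _ _)
      (i2.intervalIntegrable _ _), intervalIntegral.integral_const_mul,
      intervalIntegral.integral_const_mul] at h1
    simp only [innerProd]
    linarith
  have := discrim_le_zero key
  rw [discrim] at this
  nlinarith

lemma innerProd_sum_left (hp : IsUnitCircle N p) {ι : Type*} (S : Finset ι) (c : ι → ℝ)
    {F : ι → ℝ → ℝ} (hF : ∀ i ∈ S, Continuous (F i)) (hg : Continuous g) :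
    innerProd p (fun θ => ∑ i ∈ S, c i * F i θ) g = ∑ i ∈ S, c i * innerProd p (F i) g := by
  have hr := hp.continuous_weight
  have hi : ∀ i ∈ S, Continuous fun θ => c i * (F i θ * g θ * weight p θ) := fun i hi =>
    continuous_const.mul (((hF i hi).mul hg).mul hr)
  have e : ∀ θ, (∑ i ∈ S, c i * F i θ) * g θ * weight p θ
      = ∑ i ∈ S, c i * (F i θ * g θ * weight p θ) := fun θ => by
    rw [Finset.sum_mul, Finset.sum_mul]
    exact Finset.sum_congr rfl fun i _ => by ring
  simp only [innerProd, e]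
  rw [intervalIntegral.integral_finsetSum fun i h => (hi i h).intervalIntegrable _ _]
  simp only [intervalIntegral.integral_const_mul]

lemma innerProd_comm (f g : ℝ → ℝ) : innerProd p f g = innerProd p g f := by
  simp only [innerProd, mul_comm (f _)]

lemma innerProd_sub_left (hp : IsUnitCircle N p) {f₂ : ℝ → ℝ} (hf : Continuous f)
    (hf₂ : Continuous f₂) (hg : Continuous g) :
    innerProd p (fun θ => f θ - f₂ θ) g = innerProd p f g - innerProd p f₂ g := by
  have hr := hp.continuous_weight
  have i1 : Continuous fun θ => f θ * g θ * weight p θ := by fun_prop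
  have i2 : Continuous fun θ => f₂ θ * g θ * weight p θ := by fun_prop
  simp only [innerProd]
  rw [← intervalIntegral.integral_sub (i1.intervalIntegrable _ _) (i2.intervalIntegrable _ _)]
  simp only [sub_mul]

/-- The partial sums are orthogonal to `g`, so by Cauchy–Schwarz `⟨f, g⟩` is bounded by the norm of
the remainder times that of `g`. -/
lemma HasExpansionFrom.innerProd_eq_zero (hp : IsUnitCircle N p) {e : ℕ → Fin 2 → ℝ → ℝ}
    {k₀ : ℕ} {a : ℕ → Fin 2 → ℝ} (hf : Continuous f) (hh : HasExpansionFrom p e k₀ a f)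
    (he : ∀ k, k₀ ≤ k → ∀ i, Continuous (e k i)) (hg : Continuous g)
    (horth : ∀ k, k₀ ≤ k → ∀ i, innerProd p (e k i) g = 0) : innerProd p f g = 0 := by
  have hS : ∀ k, k₀ ≤ k → Continuous fun θ => ∑ i, a k i * e k i θ := fun k hk =>
    continuous_finsetSum _ fun i _ => continuous_const.mul (he k hk i)
  have hS' : ∀ n, Continuous fun θ => ∑ k ∈ Finset.Icc k₀ n, ∑ i, a k i * e k i θ := fun n =>
    continuous_finsetSum _ fun k hk => hS k (Finset.mem_Icc.1 hk).1
  have hS0 : ∀ n, innerProd p (fun θ => ∑ k ∈ Finset.Icc k₀ n, ∑ i, a k i * e k i θ) g = 0 := by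
    intro n
    have := innerProd_sum_left hp (Finset.Icc k₀ n) (fun _ => 1)
      (F := fun k θ => ∑ i, a k i * e k i θ) (fun k hk => hS k (Finset.mem_Icc.1 hk).1) hg
    simp only [one_mul] at this
    rw [this]
    refine Finset.sum_eq_zero fun k hk => ?_
    have hk' := (Finset.mem_Icc.1 hk).1
    rw [innerProd_sum_left hp Finset.univ (a k) (F := e k) (fun i _ => he k hk' i) hg]
    exact Finset.sum_eq_zero fun i _ => by rw [horth k hk' i, mul_zero]
  have hle : ∀ n, innerProd p f g ^ 2 ≤
      innerProd p (fun θ => f θ - ∑ k ∈ Finset.Icc k₀ n, ∑ i, a k i * e k i θ)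
        (fun θ => f θ - ∑ k ∈ Finset.Icc k₀ n, ∑ i, a k i * e k i θ) * innerProd p g g := by
    intro n
    have := innerProd_sq_le hp
      (f := fun θ => f θ - ∑ k ∈ Finset.Icc k₀ n, ∑ i, a k i * e k i θ) (hf.sub (hS' n)) hg
    rwa [innerProd_sub_left hp hf (hS' n) hg, hS0 n, sub_zero] at this
  have hlim := Tendsto.mul_const (innerProd p g g) hh
  rw [zero_mul] at hlim
  have := ge_of_tendsto' hlim hle
  exact pow_eq_zero_iff two_ne_zero |>.1 (le_antisymm this (sq_nonneg _))

end Expansion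

/-! ### The `2m + 1` lowest modes -/

section Modes

/-- The constant `1` and the functions `e k i` with `1 ≤ k ≤ m`. -/
def modes (e : ℕ → Fin 2 → ℝ → ℝ) (m : ℕ) : Option (Fin m × Fin 2) → ℝ → ℝ
  | none => fun _ => 1
  | some (k, i) => e (k + 1) i

/-- The eigenvalues of `modes`. -/
noncomputable def modeEigenvalue (p : ℝ → ℝ × ℝ) (m : ℕ) : Option (Fin m × Fin 2) → ℝ
  | none => 0
  | some (k, i) => eigenvalue p (k + 1) i

variable {N : Seminorm ℝ (ℝ × ℝ)} {p : ℝ → ℝ × ℝ} {e : ℕ → Fin 2 → ℝ → ℝ}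

lemma isPeriodicSolution_one (p : ℝ → ℝ × ℝ) :
    IsPeriodicSolution (weight p) (weight (dual p)) 0 (fun _ => 1)
      (quasiDeriv p fun _ => 1) := by
  have h : (quasiDeriv p fun _ => 1) = fun _ => 0 := by funext x; simp [quasiDeriv]
  rw [h]
  exact ⟨fun x => by simpa using hasDerivAt_const x (1 : ℝ), fun x => by
    simpa using hasDerivAt_const x (0 : ℝ), fun _ => rfl, fun _ => rfl⟩

lemma IsEigenbasis.eigenvalue_pos (hp : IsUnitCircle N p) (he : IsEigenbasis p e) {k : ℕ}
    (hk1 : 1 ≤ k) (i : Fin 2) : 0 < eigenvalue p k i := by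
  obtain ⟨u, hu, hk⟩ := he.eigenvalue_mem hp hk1 i
  exact hu.eigenvalue_pos hp hk1 hk

lemma IsEigenbasis.innerProd_of_ne (hp : IsUnitCircle N p) (he : IsEigenbasis p e) {k l : ℕ}
    (hk1 : 1 ≤ k) (hl1 : 1 ≤ l) (hkl : k ≠ l) (i j : Fin 2) :
    innerProd p (e k i) (e l j) = 0 := by
  refine ((he.isEigenfunction k hk1 i).isPeriodicSolution hp).integral_mul_eq_zero hp.isCoeff
    ((he.isEigenfunction l hl1 j).isPeriodicSolution hp) fun heq => hkl ?_
  refine index_unique hp hk1 hl1 (he.eigenvalue_mem hp hk1 i) ?_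
  rw [heq]
  exact he.eigenvalue_mem hp hl1 j

lemma IsEigenbasis.innerProd_one (hp : IsUnitCircle N p) (he : IsEigenbasis p e) {k : ℕ}
    (hk1 : 1 ≤ k) (i : Fin 2) : innerProd p (e k i) (fun _ => 1) = 0 :=
  ((he.isEigenfunction k hk1 i).isPeriodicSolution hp).integral_mul_eq_zero hp.isCoeff
    (isPeriodicSolution_one p) (he.eigenvalue_pos hp hk1 i).ne'

/-- Different indices force different eigenvalues, hence orthogonality. Within one index the two
eigenvalues may coincide, and the assumed orthonormality is used. -/
lemma IsEigenbasis.isOrthogonalFamily_modes (hp : IsUnitCircle N p) (he : IsEigenbasis p e)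
    (m : ℕ) : IsOrthogonalFamily (weight p) (weight (dual p)) (modeEigenvalue p m) (modes e m)
      fun j => quasiDeriv p (modes e m j) where
  sol j := by
    rcases j with _ | ⟨k, i⟩
    · exact isPeriodicSolution_one p
    · exact (he.isEigenfunction _ (by omega) i).isPeriodicSolution hp
  orth j l hjl := by
    change innerProd p (modes e m j) (modes e m l) = 0
    rcases j with _ | ⟨k, i⟩ <;> rcases l with _ | ⟨k', i'⟩
    · exact absurd rfl hjl
    · rw [innerProd_comm]
      exact he.innerProd_one hp (by omega) i'
    · exact he.innerProd_one hp (by omega) i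
    · by_cases hk : k = k'
      · subst hk
        have hi : i ≠ i' := fun h => hjl (by rw [h])
        simpa [modes, hi] using he.orthonormal (k + 1) (by omega) i i'
      · exact he.innerProd_of_ne hp (by omega) (by omega)
          (fun h => hk (Fin.ext (Nat.succ_injective h))) i i'
  ne_zero j := by
    rcases j with _ | ⟨k, i⟩
    · exact fun h => one_ne_zero (congrFun h 0)
    · exact (he.isEigenfunction _ (by omega) i).ne_zero

lemma IsEigenbasis.cyclicZeros_modes_le (hp : IsUnitCircle N p) (he : IsEigenbasis p e)
    (m : ℕ) (j : Option (Fin m × Fin 2)) {n : ℕ} (hz : CyclicZeros (modes e m j) n) :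
    n ≤ 2 * m := by
  rcases j with _ | ⟨k, i⟩
  · obtain ⟨t, -, -, h⟩ := hz
    exact absurd (h 0 (Nat.zero_le _)) one_ne_zero
  · have := (he.isEigenfunction _ (by omega) i).cyclicZeros_le hp (by omega)
      (he.eigenvalue_mem hp (by omega) i) hz
    have := k.2
    omega

lemma HasExpansionFrom.innerProd_modes (hp : IsUnitCircle N p) (he : IsEigenbasis p e)
    {k₀ m : ℕ} (hm : m < k₀) {a : ℕ → Fin 2 → ℝ} {f : ℝ → ℝ} (hf : Continuous f)
    (hh : HasExpansionFrom p e k₀ a f) (j : Option (Fin m × Fin 2)) :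
    innerProd p (modes e m j) f = 0 := by
  rw [innerProd_comm]
  refine hh.innerProd_eq_zero hp hf
    (fun k hk i => ((he.isEigenfunction k (by omega) i).isPeriodicSolution hp).cont_u)
    ((he.isOrthogonalFamily_modes hp m).sol j).cont_u fun k hk i => ?_
  rcases j with _ | ⟨k', i'⟩
  · exact he.innerProd_one hp (by omega) i
  · have := k'.2
    exact he.innerProd_of_ne hp (by omega) (by omega) (by omega) i i'

end Modes
end MinkowskiPlane

/-! ### The contradiction -/

theorem mainTheorem7 (N : Seminorm ℝ (ℝ × ℝ)) (p : ℝ → ℝ × ℝ)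
    (hp : MinkowskiPlane.IsUnitCircle N p)
    (e : ℕ → Fin 2 → ℝ → ℝ) (he : MinkowskiPlane.IsEigenbasis p e)
    (k₀ : ℕ) (hk₀ : 2 ≤ k₀)
    (h : ℝ → ℝ) (hcont : Continuous h) (hper : Function.Periodic h (2 * Real.pi))
    (a : ℕ → Fin 2 → ℝ) (hh : MinkowskiPlane.HasExpansionFrom p e k₀ a h) :
    ((2 * k₀ : ℕ) : ℕ∞) ≤ {θ ∈ Set.Ico 0 (2 * Real.pi) | h θ = 0}.encard := by
  classical
  open MinkowskiPlane in
  by_contra! hlt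
  have hfin : {θ ∈ Set.Ico 0 (2 * Real.pi) | h θ = 0}.Finite :=
    Set.finite_of_encard_le_coe hlt.le
  have hiso := eventually_ne_zero_of_finite hper hfin
  set T : Finset ℝ := hfin.toFinset.filter fun x => ¬ LocallyOneSigned h x with hTdef
  have hT : ∀ x, x ∈ T ↔ x ∈ Set.Ico 0 (2 * Real.pi) ∧ ¬ LocallyOneSigned h x := by
    intro x
    rw [hTdef, Finset.mem_filter, Set.Finite.mem_toFinset]
    refine ⟨fun hx => ⟨hx.1.1, hx.2⟩, fun hx => ⟨⟨hx.1, ?_⟩, hx.2⟩⟩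
    by_contra h0
    exact hx.2 (locallyOneSigned_of_ne_zero hcont.continuousAt h0)
  have hcard : T.card < 2 * k₀ := by
    rw [hfin.encard_eq_coe_toFinset_card, Nat.cast_lt] at hlt
    exact (Finset.card_filter_le _ _).trans_lt hlt
  -- Evenness makes the `2m + 1` modes exactly one more than the points of `T`, and `2m < 2 * k₀`
  -- keeps their indices below `k₀`.
  obtain ⟨m, hm⟩ := even_card_sign_changes hcont hper hiso hT
  have hfam := he.isOrthogonalFamily_modes hp m
  obtain ⟨c, hc1, hc2, hc3⟩ := hfam.exists_simple_zeros hp.isCoeff (T := T)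
    (fun j n hz => by
      have := he.cyclicZeros_modes_le hp m j hz
      omega)
    (by simp only [Fintype.card_option, Fintype.card_prod, Fintype.card_fin]; omega)
    fun x hx => ((hT x).1 hx).1
  refine integral_ne_zero_of_sign_changes (r := weight p)
    (g := fun x => ∑ j, c j * modes e m j x)
    (g' := fun x => weight (dual p) x * ∑ j, c j * quasiDeriv p (modes e m j) x)
    hcont hper hiso hT hp.continuous_weight hp.weight_pos hp.isCoeff.per_r (fun x => ?_)
    (fun x => Finset.sum_congr rfl fun j _ => by rw [(hfam.sol j).per_u])
    (fun x => ?_) (fun x hx => ⟨hc2 x hx, hc1 x⟩)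
    (fun x hx => mul_ne_zero (hp.isCoeff.pos_s x).ne' (hc3 x hx)) ?_
  · refine (HasDerivAt.fun_sum (u := Finset.univ) fun j _ =>
      ((hfam.sol j).deriv_u x).const_mul (c j)).congr_deriv ?_
    rw [Finset.mul_sum]
    exact Finset.sum_congr rfl fun j _ => by ring
  · dsimp only
    rw [hp.isCoeff.per_s x]
    exact congrArg _ (Finset.sum_congr rfl fun j _ => by rw [(hfam.sol j).per_w])
  · change innerProd p h (fun x => ∑ j, c j * modes e m j x) = 0
    rw [innerProd_comm, innerProd_sum_left hp _ c (fun j _ => (hfam.sol j).cont_u) hcont]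
    exact Finset.sum_eq_zero fun j _ => by
      rw [hh.innerProd_modes hp he (by omega) hcont j, mul_zero]
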